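/- Let $M\ge 1$ be an integer. For a real number $q>1$ and a sequence $(c_i)_{i\ge1}$ in $\{0,1,\ldots,M\}$ put $(c_i)_q:=\sum_{i\ge1}c_iq^{-i}$; the sequence is an expansion of $x$ in base $q$ if $(c_i)_q=x$. A sequence is called infinite if it has no last non-zero digit (so $0^\infty$ is infinite), and doubly infinite if both $(c_i)$ and $(M-c_i)$ are infinite. Let $\mathcal U$ and $\mathcal V$ be the sets of bases $q\in(1,M+1]$ in which $1$ has a unique expansion and a unique doubly infinite expansion, respectively, and let $\overline{\mathcal U}$ be the topological closure of $\mathcal U$. Let $\mathcal U_q$ and $\mathcal V_q$ be the sets of real numbers having a unique expansion and a unique doubly infinite expansion in base $q$, respectively; let $\mathcal U_q'$ be the set of expansions of the elements of $\mathcal U_q$, let $\mathcal V_q'$ be the set of doubly infinite expansions of the elements of $\mathcal V_q$, and let $\overline{\mathcal U_q}'$ be the set of doubly infinite expansions of the elements of the topological closure $\overline{\mathcal U_q}$ of $\mathcal U_q$. For $q\in\mathcal V\setminus\mathcal U$ the greedy (lexicographically largest) expansion of $1$ in base $q$ has a last non-zero digit; write it as $\beta_1\cdots\beta_N0^\infty$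 with $\beta_N>0$, and put $$a_i:=(\beta_i\cdots\beta_N0^\infty)_q,\qquad b_i:=\frac{M}{q-1}-a_i\qquad(1\le i\le N),\qquad S_q:=\bigcup_{j=1}^M\left[\frac jq,\ \frac{j-1}q+\frac{M}{q^2-q}\right].$$ The vertices of the labeled graph $\mathcal G(q)$ are the connected components of $\left(0,\frac{M}{q-1}\right)\setminus\left(S_q\cup\{a_1,\ldots,a_N,b_1,\ldots,b_N\}\right)$, and its edges are the triplets $(I,k,J)$ where $I,J$ are vertices, $k\in\{0,\ldots,M\}$ and $T_k(I)\supset J$ for $T_k(x):=qx-k$. Let $\mathcal G_q'$ be the set of sequences $(c_i)$ for which there are vertices $I_1,I_2,\ldots$ such that $(I_i,c_i,I_{i+1})$ is an edge for every $i\ge1$, and let $\mathcal G_q:=\{(c_i)_q:(c_i)\in\mathcal G_q'\}$. **Theorem.** (i) If $q\in\overline{\mathcal U}\setminus\mathcal U$, then $\mathcal G_q=\mathcal V_q$ and $\mathcal G_q'=\mathcal V_q'$. (ii) If $q\in\mathcal V\setminus\overline{\mathcal U}$, then $\mathcal G_q=\mathcal U_q$ and $\mathcal G_q'=\mathcal U_q'$.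 Moreover, in a uniform way: $\mathcal G_q=\overline{\mathcal U_q}$ and $\mathcal G_q'=\overline{\mathcal U_q}'$ for every $q\in\mathcal V\setminus\mathcal U$. -/

import Mathlib

namespace UnivoqueGraph

/-- Sequences over the alphabet `{0, 1, …, M}`. The term with index `i` is the digit usually
written `c_{i+1}`: indices start at `0`. -/
abbrev DigitSeq (M : ℕ) : Type := ℕ → Fin (M + 1)

/-- The value `(c_i)_q = ∑_{i ≥ 1} c_i / q ^ i`; the series converges whenever `1 < q`. -/
noncomputable def value {M : ℕ} (q : ℝ) (c : DigitSeq M) : ℝ :=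
  ∑' i : ℕ, ((c i : ℕ) : ℝ) / q ^ (i + 1)

/-- `c` is an expansion of `x` in base `q`. -/
def IsExpansion {M : ℕ} (q x : ℝ) (c : DigitSeq M) : Prop := value q c = x

/-- The last non-zero digit of `c` has index `N`. -/
def LastNonzeroAt {M : ℕ} (c : DigitSeq M) (N : ℕ) : Prop :=
  c N ≠ 0 ∧ ∀ i, N < i → c i = 0

/-- A sequence is finite if it has a last non-zero digit. -/
def IsFiniteSeq {M : ℕ} (c : DigitSeq M) : Prop := ∃ N, LastNonzeroAt c N

/-- A sequence is infinite if it is not finite; the zero sequence is infinite. -/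
def IsInfiniteSeq {M : ℕ} (c : DigitSeq M) : Prop := ¬ IsFiniteSeq c

/-- The reflection `(M - c_i)` of a sequence. -/
def reflection {M : ℕ} (c : DigitSeq M) : DigitSeq M := fun i => Fin.rev (c i)

/-- A sequence is doubly infinite if it and its reflection are infinite. -/
def IsDoublyInfinite {M : ℕ} (c : DigitSeq M) : Prop :=
  IsInfiniteSeq c ∧ IsInfiniteSeq (reflection c)

/-- The set `𝒰` of bases in which `1` has a unique expansion. -/
def basesU (M : ℕ) : Set ℝ :=
  {q | q ∈ Set.Ioc (1 : ℝ) (M + 1) ∧ ∃! c : DigitSeq M, IsExpansion q 1 c}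

/-- The set `𝒱` of bases in which `1` has a unique doubly infinite expansion. -/
def basesV (M : ℕ) : Set ℝ :=
  {q | q ∈ Set.Ioc (1 : ℝ) (M + 1) ∧ ∃! c : DigitSeq M, IsExpansion q 1 c ∧ IsDoublyInfinite c}

/-- The set `𝒰_q` of numbers with a unique expansion in base `q`. -/
def setU (M : ℕ) (q : ℝ) : Set ℝ := {x | ∃! c : DigitSeq M, IsExpansion q x c}

/-- The set `𝒱_q` of numbers with a unique doubly infinite expansion in base `q`. -/
def setV (M : ℕ) (q : ℝ) : Set ℝ :=
  {x | ∃! c : DigitSeq M, IsExpansion q x c ∧ IsDoublyInfinite c}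

/-- The set `𝒰_q'` of the unique expansions of the elements of `𝒰_q`. -/
def seqU (M : ℕ) (q : ℝ) : Set (DigitSeq M) := {c | ∃ x ∈ setU M q, IsExpansion q x c}

/-- The doubly infinite expansions in base `q` of the elements of a set `X` of numbers. -/
def doublyInfiniteExpansions (M : ℕ) (q : ℝ) (X : Set ℝ) : Set (DigitSeq M) :=
  {c | ∃ x ∈ X, IsExpansion q x c ∧ IsDoublyInfinite c}

/-- The set `𝒱_q'` of the unique doubly infinite expansions of the elements of `𝒱_q`. -/
def seqV (M : ℕ) (q : ℝ) : Set (DigitSeq M) := doublyInfiniteExpansions M q (setV M q)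

/-- `c` is the greedy, i.e. the lexicographically largest, expansion of `x` in base `q`. -/
def IsGreedyExpansion {M : ℕ} (q x : ℝ) (c : DigitSeq M) : Prop :=
  IsExpansion q x c ∧ ∀ d : DigitSeq M, IsExpansion q x d → toLex d ≤ toLex c

/-- The switch region `S_q`, the union over `j = 1, …, M` of the intervals
`[j / q, (j - 1) / q + M / (q ^ 2 - q)]`. -/
def switchRegion (M : ℕ) (q : ℝ) : Set ℝ :=
  ⋃ j ∈ Set.Icc 1 M,
    Set.Icc ((j : ℝ) / q) (((j : ℝ) - 1) / q + (M : ℝ) / (q ^ 2 - q))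

/-- The number `(c_{i+1} c_{i+2} ⋯)_q` given by a tail of `c`. -/
noncomputable def tailValue {M : ℕ} (q : ℝ) (c : DigitSeq M) (i : ℕ) : ℝ :=
  value q (fun k => c (i + k))

/-- The points `a_1, …, a_N`: the values of the tails of the finite greedy expansion of `1`
that start at or before its last non-zero digit. -/
def pointsA (M : ℕ) (q : ℝ) : Set ℝ :=
  {y | ∃ (β : DigitSeq M) (N : ℕ), IsGreedyExpansion q 1 β ∧ LastNonzeroAt β N ∧
    ∃ i ≤ N, y = tailValue q β i}

/-- The points `b_i = M / (q - 1) - a_i`. -/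
def pointsB (M : ℕ) (q : ℝ) : Set ℝ := {y | ∃ a ∈ pointsA M q, y = (M : ℝ) / (q - 1) - a}

/-- The open interval `(0, M / (q - 1))` without the switch region and the points
`a_i`, `b_i`. -/
def vertexRegion (M : ℕ) (q : ℝ) : Set ℝ :=
  Set.Ioo 0 ((M : ℝ) / (q - 1)) \ (switchRegion M q ∪ (pointsA M q ∪ pointsB M q))

/-- The vertices of `𝒢(q)`: the connected components of the vertex region. -/
def vertices (M : ℕ) (q : ℝ) : Set (Set ℝ) :=
  {I | ∃ x ∈ vertexRegion M q, I = connectedComponentIn (vertexRegion M q) x}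

/-- The triplet `(I, k, J)` is an edge of `𝒢(q)`: `I` and `J` are vertices and `T_k(I) ⊇ J`
for the affine map `T_k(x) = q x - k`. -/
def IsEdge (M : ℕ) (q : ℝ) (I : Set ℝ) (k : Fin (M + 1)) (J : Set ℝ) : Prop :=
  I ∈ vertices M q ∧ J ∈ vertices M q ∧ J ⊆ (fun x : ℝ => q * x - ((k : ℕ) : ℝ)) '' I

/-- The set `𝒢_q'` of the label sequences of the infinite paths of `𝒢(q)`. -/
def seqG (M : ℕ) (q : ℝ) : Set (DigitSeq M) :=
  {c | ∃ I : ℕ → Set ℝ, ∀ n, IsEdge M q (I n) (c n) (I (n + 1))}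

/-- The set `𝒢_q` of the numbers generated by `𝒢(q)`. -/
def setG (M : ℕ) (q : ℝ) : Set ℝ := value q '' seqG M q

end UnivoqueGraph

open UnivoqueGraph

/-! Put K = M/(q-1). A digit below M can be raised by one exactly when the next tail value is at
least 1; a non-zero digit can be lowered by one exactly when the next tail value is at most K-1.
Hence, for q < M+1, unique expansions are the sequences with `StrictOrbit`, and unique doubly
infinite expansions those with `LaxOrbit`. They differ only by contacts, where a tail equals 1
(high) or K-1 (low).

If q is in 𝒱 but not in 𝒰, the lax expansion α of 1 has a high contact, so it is periodic. After a
high contact every lax sequence continues as α, after a low contact as the reflection of α.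
Everything therefore depends on whether α itself has a low contact, that is, whether α is some word
and its reflection repeated alternately.

Graph: the points a_i, b_i make the partition Markov (`isEdge_of_meet`). Labels of paths are lax,
because path points are off the switch region and approximate the tail values. Conversely, a lax
sequence without low contact is followed by the components to the left of its tail values, one
without high contact by those to the right (`mem_seqG_of_not_contact`). If α has no low contact, no
lax sequence has both kinds, so 𝒢_q' = 𝒱_q'. If α has one, path points just below 1 are later
carried to the wrong side of K-1, so paths allow no contact and 𝒢_q' = 𝒰_q'.

Closures: without low contact, cutting α where its tail value is minimal gives strict sequences with
values close to 1 (`LaxOrbit.exists_strict_near_one`); they make 𝒰_q dense in 𝒱_q, and reflected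
they yield bases of 𝒰 tending to q. With a low contact, strict orbits form a closed set, and the
same rigidity keeps q away from 𝒰. -/

namespace UnivoqueGraph

open Filter Topology

variable {M : ℕ} {q : ℝ}

/-! ### Tail values as orbits of the digit maps -/

/-- The largest number `M / (q - 1)` having an expansion in base `q`. -/
noncomputable def maxValue (M : ℕ) (q : ℝ) : ℝ := (M : ℝ) / (q - 1)

lemma mul_maxValue (hq : 1 < q) : q * maxValue M q = M + maxValue M q := by
  have : q - 1 ≠ 0 := by linarith
  unfold maxValue
  field_simp
  ring

lemma maxValue_nonneg (hq : 1 < q) : 0 ≤ maxValue M q :=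
  div_nonneg (Nat.cast_nonneg _) (by linarith)

lemma one_lt_maxValue (hq : 1 < q) (hqM : q < M + 1) : 1 < maxValue M q := by
  unfold maxValue
  rw [one_lt_div (by linarith)]
  linarith

lemma digit_le (c : DigitSeq M) (n : ℕ) : ((c n : ℕ) : ℝ) ≤ M := by
  exact_mod_cast Nat.lt_succ_iff.mp (c n).isLt

lemma digit_le_nat (c : DigitSeq M) (n : ℕ) : (c n : ℕ) ≤ M := Nat.lt_succ_iff.mp (c n).isLt

lemma hasSum_maxValue (hq : 1 < q) :
    HasSum (fun i : ℕ => (M : ℝ) / q ^ (i + 1)) (maxValue M q) := by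
  have h0 : 0 < q := by linarith
  have h := (hasSum_geometric_of_lt_one (inv_nonneg.2 h0.le) (inv_lt_one_of_one_lt₀ hq)).mul_left
    ((M : ℝ) / q)
  have h1 : (fun i : ℕ => (M : ℝ) / q * q⁻¹ ^ i) = fun i : ℕ => (M : ℝ) / q ^ (i + 1) := by
    funext i
    rw [pow_succ, inv_pow]
    field_simp
  have h2 : (M : ℝ) / q * (1 - q⁻¹)⁻¹ = maxValue M q := by
    have : q - 1 ≠ 0 := by linarith
    have h2 : 1 - q⁻¹ ≠ 0 := by
      have := inv_lt_one_of_one_lt₀ hq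
      linarith
    unfold maxValue
    field_simp
  rwa [h1, h2] at h

lemma summable_digits (hq : 1 < q) (c : DigitSeq M) :
    Summable (fun i : ℕ => ((c i : ℕ) : ℝ) / q ^ (i + 1)) := by
  have h0 : 0 < q := by linarith
  refine Summable.of_nonneg_of_le (fun i => by positivity) (fun i => ?_)
    (hasSum_maxValue (M := M) hq).summable
  have := digit_le c i
  gcongr

lemma value_nonneg (hq : 1 < q) (c : DigitSeq M) : 0 ≤ value q c := by
  have h0 : 0 < q := by linarith
  exact tsum_nonneg (fun i => by positivity)

lemma value_le (hq : 1 < q) (c : DigitSeq M) : value q c ≤ maxValue M q := by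
  have h0 : 0 < q := by linarith
  rw [← (hasSum_maxValue (M := M) hq).tsum_eq]
  refine (summable_digits hq c).tsum_le_tsum (fun i => ?_) (hasSum_maxValue (M := M) hq).summable
  have := digit_le c i
  gcongr

lemma tailValue_zero (c : DigitSeq M) : tailValue q c 0 = value q c := by
  simp [tailValue]

lemma tailValue_tail (c : DigitSeq M) (m n : ℕ) :
    tailValue q (fun k => c (m + k)) n = tailValue q c (m + n) := by
  simp [tailValue, add_assoc]

lemma tailValue_nonneg (hq : 1 < q) (c : DigitSeq M) (n : ℕ) : 0 ≤ tailValue q c n :=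
  value_nonneg hq _

lemma tailValue_le (hq : 1 < q) (c : DigitSeq M) (n : ℕ) : tailValue q c n ≤ maxValue M q :=
  value_le hq _

lemma tailValue_succ (hq : 1 < q) (c : DigitSeq M) (n : ℕ) :
    tailValue q c (n + 1) = q * tailValue q c n - (c n : ℕ) := by
  have h0 : q ≠ 0 := by linarith
  unfold tailValue value
  rw [(summable_digits hq (fun k => c (n + k))).tsum_eq_zero_add, mul_add, ← tsum_mul_left]
  have : ∀ k : ℕ, q * (((c (n + (k + 1)) : ℕ) : ℝ) / q ^ (k + 1 + 1)) =
      ((c (n + 1 + k) : ℕ) : ℝ) / q ^ (k + 1) := by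
    intro k
    rw [pow_succ q (k + 1), show n + (k + 1) = n + 1 + k by ring]
    field_simp
  simp only [this]
  simp
  field_simp
  ring

/-- A bounded orbit of the digit maps consists of the tail values of its digits. -/
lemma eq_tailValue_of_orbit (hq : 1 < q) (c : DigitSeq M) (y : ℕ → ℝ) (C : ℝ)
    (hy : ∀ n, |y n| ≤ C) (h : ∀ n, y (n + 1) = q * y n - (c n : ℕ)) (n : ℕ) :
    y n = tailValue q c n := by
  have key : ∀ l, y (n + l) - tailValue q c (n + l) = q ^ l * (y n - tailValue q c n) := by
    intro l
    induction l with
    | zero => simp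
    | succ l ih =>
      rw [← add_assoc, h, tailValue_succ hq, pow_succ]
      linear_combination q * ih
  have hb : ∀ l, |y (n + l) - tailValue q c (n + l)| ≤ C + maxValue M q := by
    intro l
    have h1 := abs_le.1 (hy (n + l))
    have h2 := tailValue_nonneg hq c (n + l)
    have h3 := tailValue_le hq c (n + l)
    rw [abs_le]
    constructor <;> linarith
  by_contra hne
  have hpos : 0 < |y n - tailValue q c n| := abs_pos.2 (sub_ne_zero.2 hne)
  obtain ⟨l, hl⟩ := pow_unbounded_of_one_lt ((C + maxValue M q) / |y n - tailValue q c n|) hq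
  rw [div_lt_iff₀ hpos] at hl
  have := hb l
  rw [key l, abs_mul, abs_of_pos (pow_pos (by linarith) l)] at this
  linarith

lemma reflection_apply (c : DigitSeq M) (n : ℕ) :
    ((reflection c n : Fin (M + 1)) : ℕ) = M - (c n : ℕ) := by
  simp [reflection, Fin.val_rev]

lemma reflection_cast (c : DigitSeq M) (n : ℕ) :
    (((reflection c n : Fin (M + 1)) : ℕ) : ℝ) = M - ((c n : ℕ) : ℝ) := by
  rw [reflection_apply, Nat.cast_sub (digit_le_nat c n)]

lemma reflection_reflection (c : DigitSeq M) : reflection (reflection c) = c := by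
  ext n
  simp [reflection]

lemma tailValue_reflection (hq : 1 < q) (c : DigitSeq M) (n : ℕ) :
    tailValue q (reflection c) n = maxValue M q - tailValue q c n := by
  symm
  refine eq_tailValue_of_orbit hq (reflection c) (fun n => maxValue M q - tailValue q c n)
    (maxValue M q) (fun n => ?_) (fun n => ?_) n
  · have h2 := tailValue_nonneg hq c n
    have h3 := tailValue_le hq c n
    rw [abs_le]
    constructor <;> linarith
  · rw [reflection_cast, tailValue_succ hq]
    linear_combination -(mul_maxValue (M := M) hq)

lemma value_reflection (hq : 1 < q) (c : DigitSeq M) :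
    value q (reflection c) = maxValue M q - value q c := by
  simpa [tailValue_zero] using tailValue_reflection hq c 0

/-- Tail values of sequences that agree on a block of digits separate exponentially. -/
lemma tailValue_sub_of_agree (hq : 1 < q) (c e : DigitSeq M) (i j l : ℕ)
    (h : ∀ k < l, c (i + k) = e (j + k)) :
    tailValue q e (j + l) - tailValue q c (i + l) =
      q ^ l * (tailValue q e j - tailValue q c i) := by
  induction l with
  | zero => simp
  | succ l ih =>
    rw [← add_assoc, ← add_assoc, tailValue_succ hq, tailValue_succ hq, pow_succ,
      h l (Nat.lt_succ_self l)]
    linear_combination q * ih (fun k hk => h k (hk.trans (Nat.lt_succ_self l)))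

lemma tailValue_eq_zero_iff (hq : 1 < q) (c : DigitSeq M) (n : ℕ) :
    tailValue q c n = 0 ↔ ∀ k, c (n + k) = 0 := by
  have h0 : 0 < q := by linarith
  constructor
  · intro h k
    have h0' : HasSum (fun i : ℕ => ((c (n + i) : ℕ) : ℝ) / q ^ (i + 1)) 0 :=
      h ▸ (summable_digits hq (fun k => c (n + k))).hasSum
    have h1 := (hasSum_zero_iff_of_nonneg (fun i => by positivity)).1 h0'
    have h2 := congrFun h1 k
    have h3 : q ^ (k + 1) ≠ 0 := by positivity
    simp only [Pi.zero_apply, div_eq_zero_iff, h3, or_false, Nat.cast_eq_zero] at h2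
    exact Fin.ext h2
  · intro h
    simp [tailValue, value, h]

/-- Distinct expansions of the same number first differ at an index with equal tail values. -/
lemma exists_first_difference (hq : 1 < q) {c e : DigitSeq M} (hv : value q c = value q e)
    (hne : c ≠ e) : ∃ n, c n ≠ e n ∧ (∀ k < n, c k = e k) ∧
      (c n : ℕ) + tailValue q c (n + 1) = (e n : ℕ) + tailValue q e (n + 1) := by
  classical
  have hex : ∃ n, c n ≠ e n := Function.ne_iff.1 hne
  refine ⟨Nat.find hex, Nat.find_spec hex, fun k hk => not_not.1 (Nat.find_min hex hk), ?_⟩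
  have h := tailValue_sub_of_agree hq c e 0 0 (Nat.find hex)
    (fun k hk => by simpa using not_not.1 (Nat.find_min hex hk))
  simp only [zero_add, tailValue_zero, hv, sub_self, mul_zero] at h
  rw [tailValue_succ hq, tailValue_succ hq]
  linear_combination -q * h

/-! ### Continuity in the base and in the sequence -/

lemma continuousAt_value (hq : 1 < q) (c : DigitSeq M) :
    ContinuousAt (fun p : ℝ × DigitSeq M => value p.1 p.2) (q, c) := by
  -- On bases above ρ the series is dominated by the convergent series of M/ρ^(i+1).
  obtain ⟨ρ, h1, h2⟩ := exists_between hq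
  have hopen : IsOpen {p : ℝ × DigitSeq M | ρ < p.1} := isOpen_lt continuous_const continuous_fst
  have hcont : ContinuousOn (fun p : ℝ × DigitSeq M => value p.1 p.2) {p | ρ < p.1} := by
    unfold value
    refine continuousOn_tsum (u := fun i => (M : ℝ) / ρ ^ (i + 1)) (fun i => ?_)
      (hasSum_maxValue h1).summable (fun i p hp => ?_)
    · refine ContinuousOn.div ?_ (by fun_prop) (fun p hp => ?_)
      · have : Continuous (fun d : Fin (M + 1) => ((d : ℕ) : ℝ)) := continuous_of_discreteTopology
        exact (this.comp ((continuous_apply i).comp continuous_snd)).continuousOn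
      · have : 0 < p.1 := lt_trans (by linarith) hp
        positivity
    · have hp' : ρ < p.1 := hp
      have h0 : 0 < ρ := by linarith
      have h0' : 0 < p.1 := by linarith
      rw [Real.norm_of_nonneg (by positivity)]
      have := digit_le p.2 i
      gcongr
  exact hcont.continuousAt (hopen.mem_nhds h2)

lemma continuousAt_tailValue (hq : 1 < q) (c : DigitSeq M) (n : ℕ) :
    ContinuousAt (fun p : ℝ × DigitSeq M => tailValue p.1 p.2 n) (q, c) := by
  have h : ContinuousAt (fun p : ℝ × DigitSeq M => (p.1, fun k => p.2 (n + k))) (q, c) := by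
    apply Continuous.continuousAt
    fun_prop
  exact ContinuousAt.comp (f := fun p : ℝ × DigitSeq M => (p.1, fun k => p.2 (n + k)))
    (g := fun p : ℝ × DigitSeq M => value p.1 p.2)
    (continuousAt_value hq (fun k => c (n + k))) h

lemma continuous_tailValue (hq : 1 < q) (n : ℕ) :
    Continuous (fun c : DigitSeq M => tailValue q c n) := by
  rw [continuous_iff_continuousAt]
  intro c
  exact ContinuousAt.comp (f := fun c : DigitSeq M => (q, c))
    (g := fun p : ℝ × DigitSeq M => tailValue p.1 p.2 n)
    (continuousAt_tailValue hq c n) (by fun_prop)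

lemma continuousAt_tailValue_base (hq : 1 < q) (c : DigitSeq M) (n : ℕ) :
    ContinuousAt (fun r : ℝ => tailValue r c n) q :=
  ContinuousAt.comp (f := fun r : ℝ => (r, c))
    (g := fun p : ℝ × DigitSeq M => tailValue p.1 p.2 n)
    (continuousAt_tailValue hq c n) (by fun_prop)

lemma continuousAt_maxValue (hq : 1 < q) : ContinuousAt (maxValue M) q := by
  unfold maxValue
  exact ContinuousAt.div continuousAt_const (by fun_prop) (by linarith)

lemma value_lt_of_base_lt {r : ℝ} (hr : 1 < r) (hrq : r < q) (c : DigitSeq M)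
    (hc : 0 < (c 0 : ℕ)) : value q c < value r c := by
  have h0 : 0 < r := by linarith
  refine (summable_digits (hr.trans hrq) c).tsum_lt_tsum (i := 0) (fun i => ?_) ?_
    (summable_digits hr c)
  · dsimp only
    gcongr
  · have : (0 : ℝ) < (c 0 : ℕ) := by exact_mod_cast hc
    gcongr

/-! ### Splicing; strict and lax orbits as unique expansions -/

/-- `c` with its digits from index `n` on replaced by `d`. -/
def splice (c : DigitSeq M) (n : ℕ) (d : DigitSeq M) : DigitSeq M :=
  fun i => if i < n then c i else d (i - n)

lemma splice_of_lt (c d : DigitSeq M) {n i : ℕ} (h : i < n) : splice c n d i = c i := by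
  simp [splice, h]

lemma splice_add (c d : DigitSeq M) (n i : ℕ) : splice c n d (n + i) = d i := by
  simp [splice]

lemma tailValue_splice_add (c d : DigitSeq M) (n i : ℕ) :
    tailValue q (splice c n d) (n + i) = tailValue q d i := by
  simp [tailValue, add_assoc, splice_add]

lemma tailValue_splice_of_le (hq : 1 < q) (c d : DigitSeq M) {n i : ℕ} (h : i ≤ n) :
    value q d - tailValue q c n =
      q ^ (n - i) * (tailValue q (splice c n d) i - tailValue q c i) := by
  have := tailValue_sub_of_agree hq c (splice c n d) i i (n - i)
    (fun k hk => (splice_of_lt c d (by omega)).symm)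
  have h2 := tailValue_splice_add (q := q) c d n 0
  rw [add_zero, tailValue_zero] at h2
  rwa [Nat.add_sub_cancel' h, h2] at this

/-- The tail values of `c` stay off the switch region. -/
def StrictOrbit (q : ℝ) (c : DigitSeq M) : Prop :=
  ∀ n, ((c n : ℕ) < M → tailValue q c (n + 1) < 1) ∧
    (0 < (c n : ℕ) → maxValue M q - 1 < tailValue q c (n + 1))

/-- The tail values of `c` stay off the interior of the switch region. -/
def LaxOrbit (q : ℝ) (c : DigitSeq M) : Prop :=
  ∀ n, ((c n : ℕ) < M → tailValue q c (n + 1) ≤ 1) ∧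
    (0 < (c n : ℕ) → maxValue M q - 1 ≤ tailValue q c (n + 1))

lemma StrictOrbit.lax {c : DigitSeq M} (h : StrictOrbit q c) : LaxOrbit q c :=
  fun n => ⟨fun hn => ((h n).1 hn).le, fun hn => ((h n).2 hn).le⟩

lemma StrictOrbit.reflect (hq : 1 < q) {c : DigitSeq M} (h : StrictOrbit q c) :
    StrictOrbit q (reflection c) := by
  intro n
  rw [tailValue_reflection hq, reflection_apply]
  have := digit_le_nat c n
  refine ⟨fun hn => ?_, fun hn => ?_⟩
  · have := (h n).2 (by omega)
    linarith
  · have := (h n).1 (by omega)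
    linarith

lemma LaxOrbit.reflect (hq : 1 < q) {c : DigitSeq M} (h : LaxOrbit q c) :
    LaxOrbit q (reflection c) := by
  intro n
  rw [tailValue_reflection hq, reflection_apply]
  have := digit_le_nat c n
  refine ⟨fun hn => ?_, fun hn => ?_⟩
  · have := (h n).2 (by omega)
    linarith
  · have := (h n).1 (by omega)
    linarith

lemma LaxOrbit.tail {c : DigitSeq M} (h : LaxOrbit q c) (m : ℕ) :
    LaxOrbit q (fun k => c (m + k)) := by
  intro n
  rw [tailValue_tail]
  exact h (m + n)

lemma exists_digit (hq : 1 < q) (hqM : q < M + 1) {y : ℝ} (hy : y ∈ Set.Ioo 0 (maxValue M q)) :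
    ∃ k : Fin (M + 1), q * y - (k : ℕ) ∈ Set.Ioo 0 (maxValue M q) := by
  have hK := one_lt_maxValue hq hqM
  have h0 : 0 < q * y := mul_pos (by linarith) hy.1
  rcases lt_or_ge (M : ℝ) (q * y) with h | h
  · refine ⟨Fin.last M, by simpa using h, ?_⟩
    have h1 : q * y < q * maxValue M q := mul_lt_mul_of_pos_left hy.2 (by linarith)
    rw [mul_maxValue hq] at h1
    simp only [Fin.val_last]
    linarith
  -- The quasi-greedy digit ⌈qy⌉ - 1 sends y into (0, 1], and 1 < K.
  · have h1 := Nat.ceil_lt_add_one h0.le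
    have h2 := Nat.le_ceil (q * y)
    have h3 : 0 < ⌈q * y⌉₊ := Nat.ceil_pos.2 h0
    have h4 : ⌈q * y⌉₊ ≤ M := Nat.ceil_le.2 h
    refine ⟨⟨⌈q * y⌉₊ - 1, by omega⟩, ?_⟩
    simp only [Nat.cast_sub (show 1 ≤ ⌈q * y⌉₊ from h3), Nat.cast_one]
    constructor <;> linarith

lemma exists_expansion (hq : 1 < q) (hqM : q < M + 1) {x : ℝ}
    (hx : x ∈ Set.Ioo 0 (maxValue M q)) :
    ∃ c : DigitSeq M, value q c = x ∧ ∀ n, tailValue q c n ∈ Set.Ioo 0 (maxValue M q) := by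
  choose k hk using fun y : Set.Ioo 0 (maxValue M q) => exists_digit hq hqM y.2
  let f : Set.Ioo 0 (maxValue M q) → Set.Ioo 0 (maxValue M q) := fun y => ⟨_, hk y⟩
  let y : ℕ → Set.Ioo 0 (maxValue M q) := fun n => f^[n] ⟨x, hx⟩
  let c : DigitSeq M := fun n => k (y n)
  have h : ∀ n, (y n : ℝ) = tailValue q c n := by
    refine eq_tailValue_of_orbit hq c (fun n => (y n : ℝ)) (maxValue M q) (fun n => ?_)
      (fun n => ?_)
    · rw [abs_of_pos (y n).2.1]
      exact (y n).2.2.le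
    · simp only [y, Function.iterate_succ_apply', f, c]
  refine ⟨c, ?_, fun n => h n ▸ (y n).2⟩
  rw [← tailValue_zero, ← h]
  rfl

lemma isDoublyInfinite_of_frequently (hq : 1 < q) {c : DigitSeq M}
    (h : ∀ n, ∃ k ≥ n, tailValue q c k ∈ Set.Ioo 0 (maxValue M q)) : IsDoublyInfinite c := by
  constructor
  · rintro ⟨N, -, hN⟩
    obtain ⟨k, hk, hk0, -⟩ := h (N + 1)
    exact hk0.ne' ((tailValue_eq_zero_iff hq c k).2 fun i => hN _ (by omega))
  · rintro ⟨N, -, hN⟩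
    obtain ⟨k, hk, -, hk0⟩ := h (N + 1)
    have := (tailValue_eq_zero_iff hq (reflection c) k).2 fun i => hN _ (by omega)
    rw [tailValue_reflection hq] at this
    linarith

lemma exists_expansion_of_mem_Icc (hq : 1 < q) (hqM : q < M + 1) {x : ℝ}
    (hx : x ∈ Set.Icc 0 (maxValue M q)) : ∃ c : DigitSeq M, value q c = x ∧
      (x ∈ Set.Ioo 0 (maxValue M q) → ∀ n, tailValue q c n ∈ Set.Ioo 0 (maxValue M q)) := by
  have hz : value q (fun _ => 0 : DigitSeq M) = 0 := by simp [value]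
  rcases hx.1.eq_or_lt with h | h
  · exact ⟨fun _ => 0, hz.trans h, fun h' => absurd h (h'.1.ne)⟩
  rcases hx.2.eq_or_lt with h1 | h1
  · refine ⟨reflection (fun _ => 0), ?_, fun h' => absurd h1 (h'.2.ne)⟩
    rw [value_reflection hq, hz, sub_zero, h1]
  · obtain ⟨c, h2, h3⟩ := exists_expansion hq hqM ⟨h, h1⟩
    exact ⟨c, h2, fun _ => h3⟩

/-- If another digit is admissible at the `n`th step of an expansion, then there is an expansion
with that digit. -/
lemma exists_change_digit (hq : 1 < q) (hqM : q < M + 1) (c : DigitSeq M) (n : ℕ)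
    (k : Fin (M + 1)) (h : q * tailValue q c n - (k : ℕ) ∈ Set.Icc 0 (maxValue M q)) :
    ∃ e : DigitSeq M, value q e = value q c ∧ e n = k ∧
      (q * tailValue q c n - (k : ℕ) ∈ Set.Ioo 0 (maxValue M q) → IsDoublyInfinite e) := by
  have h0 : 0 < q := by linarith
  obtain ⟨d, hd, hdi⟩ := exists_expansion_of_mem_Icc hq hqM h
  let d' : DigitSeq M := splice (fun _ => k) 1 d
  have hd1 : tailValue q d' 1 = value q d := by
    rw [← tailValue_zero]
    exact tailValue_splice_add _ d 1 0
  have hd0 : (d' 0) = k := splice_of_lt _ _ Nat.zero_lt_one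
  have hv : value q d' = tailValue q c n := by
    have := tailValue_succ hq d' 0
    rw [zero_add, hd1, hd0, hd, tailValue_zero] at this
    have h1 : q * (value q d' - tailValue q c n) = 0 := by linarith
    rcases mul_eq_zero.1 h1 with h2 | h2 <;> linarith
  refine ⟨splice c n d', ?_, ?_, fun hi => isDoublyInfinite_of_frequently hq fun l => ?_⟩
  · have := tailValue_splice_of_le hq c d' (Nat.zero_le n)
    rw [hv, sub_self, tailValue_zero, tailValue_zero] at this
    rcases mul_eq_zero.1 this.symm with h2 | h2
    · exact absurd h2 (pow_pos h0 _).ne'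
    · linarith
  · exact (splice_add c d' n 0).trans hd0
  · refine ⟨n + (1 + l), by omega, ?_⟩
    rw [tailValue_splice_add, tailValue_splice_add]
    exact hdi hi l

/-- Where an inequality fails, the digit can be changed by one with the new tail value still in [0,
K], which produces a second expansion. -/
lemma strictOrbit_of_mem_seqU (hq : 1 < q) (hqM : q < M + 1) {c : DigitSeq M}
    (hc : ∀ e : DigitSeq M, value q e = value q c → e = c) : StrictOrbit q c := by
  have hK := one_lt_maxValue hq hqM
  intro n
  have h1 := tailValue_nonneg hq c (n + 1)
  have h2 := tailValue_le hq c (n + 1)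
  have h3 := tailValue_succ hq c n
  constructor
  · intro hn
    by_contra! hlt
    have hk : ((⟨c n + 1, by omega⟩ : Fin (M + 1)) : ℕ) = c n + 1 := rfl
    obtain ⟨e, he, hen, -⟩ := exists_change_digit hq hqM c n ⟨c n + 1, by omega⟩
      (by rw [hk]; push_cast; constructor <;> linarith)
    rw [hc e he] at hen
    have := congrArg Fin.val hen
    simp at this
  · intro hn
    by_contra! hlt
    have hcn := digit_le_nat c n
    have hk : ((⟨c n - 1, by omega⟩ : Fin (M + 1)) : ℕ) = c n - 1 := rfl
    obtain ⟨e, he, hen, -⟩ := exists_change_digit hq hqM c n ⟨c n - 1, by omega⟩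
      (by rw [hk, Nat.cast_sub (by omega)]; push_cast; constructor <;> linarith)
    rw [hc e he] at hen
    have := congrArg Fin.val hen
    simp at this
    omega

/-- A strict violation puts the changed tail value inside the open interval (0, K), where the
expansion can be continued in a doubly infinite way; this is why only weak inequalities follow here.
-/
lemma laxOrbit_of_mem_seqV (hq : 1 < q) (hqM : q < M + 1) {c : DigitSeq M}
    (hc : ∀ e : DigitSeq M, value q e = value q c → IsDoublyInfinite e → e = c) :
    LaxOrbit q c := by
  have hK := one_lt_maxValue hq hqM
  intro n
  have h1 := tailValue_nonneg hq c (n + 1)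
  have h2 := tailValue_le hq c (n + 1)
  have h3 := tailValue_succ hq c n
  constructor
  · intro hn
    by_contra! hlt
    have hk : ((⟨c n + 1, by omega⟩ : Fin (M + 1)) : ℕ) = c n + 1 := rfl
    have hI : q * tailValue q c n - ((⟨c n + 1, by omega⟩ : Fin (M + 1)) : ℕ) ∈
        Set.Ioo 0 (maxValue M q) := by
      rw [hk]; push_cast; constructor <;> linarith
    obtain ⟨e, he, hen, hdi⟩ := exists_change_digit hq hqM c n _ (Set.Ioo_subset_Icc_self hI)
    rw [hc e he (hdi hI)] at hen
    have := congrArg Fin.val hen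
    simp at this
  · intro hn
    by_contra! hlt
    have hcn := digit_le_nat c n
    have hk : ((⟨c n - 1, by omega⟩ : Fin (M + 1)) : ℕ) = c n - 1 := rfl
    have hI : q * tailValue q c n - ((⟨c n - 1, by omega⟩ : Fin (M + 1)) : ℕ) ∈
        Set.Ioo 0 (maxValue M q) := by
      rw [hk, Nat.cast_sub (by omega)]; push_cast; constructor <;> linarith
    obtain ⟨e, he, hen, hdi⟩ := exists_change_digit hq hqM c n _ (Set.Ioo_subset_Icc_self hI)
    rw [hc e he (hdi hI)] at hen
    have := congrArg Fin.val hen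
    simp at this
    omega

/-- At the first difference the digits differ by at least 1, which the tail values must compensate;
this would push the tail value of `e` out of [0, K]. -/
lemma StrictOrbit.unique (hq : 1 < q) {c e : DigitSeq M} (hc : StrictOrbit q c)
    (he : value q e = value q c) : e = c := by
  by_contra hne
  obtain ⟨n, hn, -, hs⟩ := exists_first_difference hq he hne
  have h1 := tailValue_nonneg hq e (n + 1)
  have h2 := tailValue_le hq e (n + 1)
  have h3 := digit_le_nat e n
  have h4 := digit_le_nat c n
  rcases lt_or_gt_of_ne (fun h => hn (Fin.ext h)) with h | h
  · have h5 := (hc n).2 (by omega)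
    have h6 : ((e n : ℕ) : ℝ) + 1 ≤ (c n : ℕ) := by exact_mod_cast h
    linarith
  · have h5 := (hc n).1 (by omega)
    have h6 : ((c n : ℕ) : ℝ) + 1 ≤ (e n : ℕ) := by exact_mod_cast h
    linarith

/-- After a last non-zero digit the tail value is 0, below K-1. This needs K > 1, that is, q < M+1.
-/
lemma LaxOrbit.isInfiniteSeq (hq : 1 < q) (hqM : q < M + 1) {c : DigitSeq M}
    (hc : LaxOrbit q c) : IsInfiniteSeq c := by
  have hK := one_lt_maxValue hq hqM
  rintro ⟨N, hN, hz⟩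
  have h1 := (tailValue_eq_zero_iff hq c (N + 1)).2 fun i => hz _ (by omega)
  have h2 := (hc N).2 (Nat.pos_of_ne_zero fun h => hN (Fin.ext h))
  linarith

lemma LaxOrbit.isDoublyInfinite (hq : 1 < q) (hqM : q < M + 1) {c : DigitSeq M}
    (hc : LaxOrbit q c) : IsDoublyInfinite c :=
  ⟨hc.isInfiniteSeq hq hqM, (hc.reflect hq).isInfiniteSeq hq hqM⟩

lemma IsInfiniteSeq.tailValue_pos (hq : 1 < q) {c : DigitSeq M} (hc : IsInfiniteSeq c) {n : ℕ}
    (hn : 0 < (c n : ℕ)) : 0 < tailValue q c (n + 1) := by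
  refine (tailValue_nonneg hq c _).lt_of_ne' fun h => hc ⟨n, fun h0 => ?_, fun i hi => ?_⟩
  · simp [h0] at hn
  · obtain ⟨j, rfl⟩ := Nat.exists_eq_add_of_lt hi
    have := (tailValue_eq_zero_iff hq c (n + 1)).1 h j
    rwa [show n + j + 1 = n + 1 + j by ring]

/-- As in the strict case, except that weak inequalities leave the tail values 0 and K possible for
`e`; double infiniteness rules these out. -/
lemma LaxOrbit.unique (hq : 1 < q) {c e : DigitSeq M} (hc : LaxOrbit q c)
    (he : value q e = value q c) (hdi : IsDoublyInfinite e) : e = c := by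
  by_contra hne
  obtain ⟨n, hn, -, hs⟩ := exists_first_difference hq he hne
  have h3 := digit_le_nat e n
  have h4 := digit_le_nat c n
  rcases lt_or_gt_of_ne (fun h => hn (Fin.ext h)) with h | h
  · have h5 := (hc n).2 (by omega)
    have h6 : ((e n : ℕ) : ℝ) + 1 ≤ (c n : ℕ) := by exact_mod_cast h
    have h7 := hdi.2.tailValue_pos hq (n := n) (by rw [reflection_apply]; omega)
    rw [tailValue_reflection hq] at h7
    linarith
  · have h5 := (hc n).1 (by omega)
    have h6 : ((c n : ℕ) : ℝ) + 1 ≤ (e n : ℕ) := by exact_mod_cast h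
    have h7 := hdi.1.tailValue_pos hq (n := n) (by omega)
    linarith

lemma LaxOrbit.ext (hq : 1 < q) (hqM : q < M + 1) {c e : DigitSeq M} (hc : LaxOrbit q c)
    (he : LaxOrbit q e) (h : value q e = value q c) : e = c :=
  hc.unique hq h (he.isDoublyInfinite hq hqM)

lemma mem_seqU_iff (hq : 1 < q) (hqM : q < M + 1) {c : DigitSeq M} :
    c ∈ seqU M q ↔ StrictOrbit q c := by
  constructor
  · rintro ⟨x, ⟨d, -, hd⟩, hx⟩
    refine strictOrbit_of_mem_seqU hq hqM fun e he => ?_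
    rw [hd c hx, hd e (he.trans hx)]
  · intro h
    exact ⟨value q c, ⟨c, rfl, fun e he => h.unique hq he⟩, rfl⟩

lemma mem_seqV_iff (hq : 1 < q) (hqM : q < M + 1) {c : DigitSeq M} :
    c ∈ seqV M q ↔ LaxOrbit q c := by
  constructor
  · rintro ⟨x, ⟨d, -, hd⟩, hx, hdi⟩
    refine laxOrbit_of_mem_seqV hq hqM fun e he hei => ?_
    rw [hd c ⟨hx, hdi⟩, hd e ⟨he.trans hx, hei⟩]
  · intro h
    have hdi := h.isDoublyInfinite hq hqM
    exact ⟨value q c, ⟨c, ⟨rfl, hdi⟩, fun e he => h.unique hq he.1 he.2⟩, rfl, hdi⟩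

lemma setU_eq_image : setU M q = value q '' seqU M q := by
  ext x
  constructor
  · rintro ⟨c, hc, hu⟩
    exact ⟨c, ⟨x, ⟨c, hc, hu⟩, hc⟩, hc⟩
  · rintro ⟨c, ⟨y, hy, hc⟩, rfl⟩
    rwa [show value q c = y from hc]

lemma setV_eq_image : setV M q = value q '' seqV M q := by
  ext x
  constructor
  · rintro ⟨c, hc, hu⟩
    exact ⟨c, ⟨x, ⟨c, hc, hu⟩, hc⟩, hc.1⟩
  · rintro ⟨c, ⟨y, hy, hc, -⟩, rfl⟩
    rwa [show value q c = y from hc]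

lemma mem_basesU_iff (hq : 1 < q) (hqM : q < M + 1) :
    q ∈ basesU M ↔ ∃ α : DigitSeq M, value q α = 1 ∧ StrictOrbit q α := by
  constructor
  · rintro ⟨-, α, hα, hu⟩
    exact ⟨α, hα, (mem_seqU_iff hq hqM).1 ⟨1, ⟨α, hα, hu⟩, hα⟩⟩
  · rintro ⟨α, hα, hs⟩
    exact ⟨⟨hq, hqM.le⟩, α, hα, fun e he => hs.unique hq (he.trans hα.symm)⟩

lemma mem_basesV_iff (hq : 1 < q) (hqM : q < M + 1) :
    q ∈ basesV M ↔ ∃ α : DigitSeq M, value q α = 1 ∧ LaxOrbit q α := by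
  constructor
  · rintro ⟨-, α, hα, hu⟩
    exact ⟨α, hα.1, (mem_seqV_iff hq hqM).1 ⟨1, ⟨α, hα, hu⟩, hα⟩⟩
  · rintro ⟨α, hα, hs⟩
    exact ⟨⟨hq, hqM.le⟩, α, ⟨hα, hs.isDoublyInfinite hq hqM⟩,
      fun e he => hs.unique hq (he.1.trans hα.symm) he.2⟩

/-- Here K = 1, so only the sequence of digits M represents 1. Consequently a base outside 𝒰
satisfies q < M+1, as assumed nearly everywhere else. -/
lemma succ_mem_basesU (hM : 1 ≤ M) : ((M : ℝ) + 1) ∈ basesU M := by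
  have hM' : (1 : ℝ) ≤ M := by exact_mod_cast hM
  have hq : (1 : ℝ) < M + 1 := by linarith
  have hK : maxValue M ((M : ℝ) + 1) = 1 := by
    unfold maxValue
    rw [add_sub_cancel_right, div_self (by linarith)]
  have hz : value ((M : ℝ) + 1) (fun _ => 0 : DigitSeq M) = 0 := by simp [value]
  refine ⟨⟨hq, le_rfl⟩, reflection (fun _ => 0), ?_, fun e he => ?_⟩
  · show value _ _ = 1
    rw [value_reflection hq, hz, hK, sub_zero]
  · have h1 : value ((M : ℝ) + 1) (reflection e) = 0 := by
      rw [value_reflection hq, hK, show value ((M : ℝ) + 1) e = 1 from he, sub_self]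
    rw [← tailValue_zero] at h1
    have h2 := (tailValue_eq_zero_iff hq _ 0).1 h1
    rw [← reflection_reflection e]
    congr 1
    funext k
    simpa using h2 k

/-! ### Contacts and the lax expansion of 1 -/

/-- Some tail of `c` following a digit less than `M` has the value `1`. -/
def HighContact (q : ℝ) (c : DigitSeq M) : Prop :=
  ∃ n, (c n : ℕ) < M ∧ tailValue q c (n + 1) = 1

/-- Some tail of `c` following a non-zero digit has the value `M / (q - 1) - 1`. -/
def LowContact (q : ℝ) (c : DigitSeq M) : Prop :=
  ∃ n, 0 < (c n : ℕ) ∧ tailValue q c (n + 1) = maxValue M q - 1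

lemma LaxOrbit.strictOrbit {c : DigitSeq M} (hc : LaxOrbit q c) (hh : ¬ HighContact q c)
    (hl : ¬ LowContact q c) : StrictOrbit q c := fun n =>
  ⟨fun h => ((hc n).1 h).lt_of_ne fun e => hh ⟨n, h, e⟩,
    fun h => ((hc n).2 h).lt_of_ne' fun e => hl ⟨n, h, e⟩⟩

lemma highContact_reflection (hq : 1 < q) {c : DigitSeq M} :
    HighContact q (reflection c) ↔ LowContact q c := by
  refine exists_congr fun n => ?_
  have := digit_le_nat c n
  rw [reflection_apply, tailValue_reflection hq]
  refine and_congr (by omega) ⟨fun h => by linarith, fun h => by linarith⟩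

lemma lowContact_reflection (hq : 1 < q) {c : DigitSeq M} :
    LowContact q (reflection c) ↔ HighContact q c := by
  rw [← highContact_reflection hq, reflection_reflection]

section LaxExpansionOfOne

variable {α c : DigitSeq M}

lemma LaxOrbit.digit_zero_pos (hq : 1 < q) (hqM : q < M + 1) (hα : LaxOrbit q α)
    (h1 : value q α = 1) : 0 < (α 0 : ℕ) := by
  by_contra! h
  have h0 : (α 0 : ℕ) = 0 := by omega
  have hM : 0 < M := by
    have : (0 : ℝ) < M := by linarith
    exact_mod_cast this
  have h2 := (hα 0).1 (by omega)
  rw [tailValue_succ hq, tailValue_zero, h1, h0] at h2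
  simp only [Nat.cast_zero] at h2
  linarith

/-- The lax condition bounds only tails that follow a digit below M. After a digit M the bound is
inherited, since qt - M ≤ q - M < 1 for t ≤ 1. -/
lemma LaxOrbit.tailValue_le_one (hq : 1 < q) (hqM : q < M + 1) (hα : LaxOrbit q α)
    (h1 : value q α = 1) (n : ℕ) : tailValue q α n ≤ 1 := by
  induction n with
  | zero => rw [tailValue_zero, h1]
  | succ n ih =>
    rcases (digit_le_nat α n).lt_or_eq with h | h
    · exact (hα n).1 h
    · rw [tailValue_succ hq, h]
      nlinarith

lemma LaxOrbit.le_tailValue (hq : 1 < q) (hqM : q < M + 1) (hα : LaxOrbit q α)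
    (h1 : value q α = 1) (n : ℕ) : maxValue M q - 1 ≤ tailValue q α n := by
  induction n with
  | zero =>
    rw [tailValue_zero, h1]
    have h2 := (hα 0).2 (hα.digit_zero_pos hq hqM h1)
    exact h2.trans (hα.tailValue_le_one hq hqM h1 1)
  | succ n ih =>
    rcases Nat.eq_zero_or_pos (α n : ℕ) with h | h
    · rw [tailValue_succ hq, h]
      have := tailValue_nonneg hq α n
      simp only [Nat.cast_zero]
      nlinarith
    · exact (hα n).2 h

lemma LaxOrbit.lt_tailValue (hq : 1 < q) (hqM : q < M + 1) (hα : LaxOrbit q α)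
    (h1 : value q α = 1) (hl : ¬ LowContact q α) (n : ℕ) :
    maxValue M q - 1 < tailValue q α n := by
  have hl' : ∀ n, 0 < (α n : ℕ) → maxValue M q - 1 < tailValue q α (n + 1) :=
    fun n h => ((hα n).2 h).lt_of_ne' fun e => hl ⟨n, h, e⟩
  induction n with
  | zero =>
    have h2 := hl' 0 (hα.digit_zero_pos hq hqM h1)
    have h3 := hα.tailValue_le_one hq hqM h1 1
    rw [tailValue_zero, h1]
    exact h2.trans_le h3
  | succ n ih =>
    rcases Nat.eq_zero_or_pos (α n : ℕ) with h | h
    · rw [tailValue_succ hq, h]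
      have := tailValue_nonneg hq α n
      simp only [Nat.cast_zero]
      nlinarith
    · exact hl' n h

lemma LaxOrbit.maxValue_le_two (hq : 1 < q) (hqM : q < M + 1) (hα : LaxOrbit q α)
    (h1 : value q α = 1) : maxValue M q ≤ 2 := by
  have h2 := hα.le_tailValue hq hqM h1 0
  rw [tailValue_zero, h1] at h2
  linarith

/-- A tail with the value `1` is the lax expansion of `1`. -/
lemma LaxOrbit.tail_eq (hq : 1 < q) (hqM : q < M + 1) (hα : LaxOrbit q α) (h1 : value q α = 1)
    (hc : LaxOrbit q c) {n : ℕ} (hn : tailValue q c n = 1) (k : ℕ) : c (n + k) = α k :=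
  congrFun (hα.ext hq hqM (hc.tail n) (hn.trans h1.symm)) k

lemma LaxOrbit.tailValue_add (hq : 1 < q) (hqM : q < M + 1) (hα : LaxOrbit q α)
    (h1 : value q α = 1) (hc : LaxOrbit q c) {n : ℕ} (hn : tailValue q c n = 1) (k : ℕ) :
    tailValue q c (n + k) = tailValue q α k := by
  rw [← tailValue_tail, funext (hα.tail_eq hq hqM h1 hc hn)]

lemma LaxOrbit.tail_eq_reflection (hq : 1 < q) (hqM : q < M + 1) (hα : LaxOrbit q α)
    (h1 : value q α = 1) (hc : LaxOrbit q c) {n : ℕ}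
    (hn : tailValue q c n = maxValue M q - 1) (k : ℕ) : c (n + k) = reflection α k :=
  congrFun ((hα.reflect hq).ext hq hqM (hc.tail n)
    (by rw [value_reflection hq, h1]; exact hn)) k

lemma LaxOrbit.tailValue_add_reflection (hq : 1 < q) (hqM : q < M + 1) (hα : LaxOrbit q α)
    (h1 : value q α = 1) (hc : LaxOrbit q c) {n : ℕ}
    (hn : tailValue q c n = maxValue M q - 1) (k : ℕ) :
    tailValue q c (n + k) = maxValue M q - tailValue q α k := by
  rw [← tailValue_tail, funext (hα.tail_eq_reflection hq hqM h1 hc hn), tailValue_reflection hq]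

/-- After a low contact α continues as its reflection; running through the same block once more
reflects back to α, so the tail value 1 recurs. -/
lemma LaxOrbit.highContact_of_lowContact (hq : 1 < q) (hqM : q < M + 1) (hα : LaxOrbit q α)
    (h1 : value q α = 1) (hl : LowContact q α) : HighContact q α := by
  obtain ⟨n, hn, ht⟩ := hl
  refine ⟨n + 1 + n, ?_, ?_⟩
  · rw [hα.tail_eq_reflection hq hqM h1 hα ht, reflection_apply]
    have := digit_le_nat α n
    omega
  · rw [add_assoc (n + 1) n 1, hα.tailValue_add_reflection hq hqM h1 hα ht, ht]
    ring

lemma LaxOrbit.highContact (hq : 1 < q) (hqM : q < M + 1) (hα : LaxOrbit q α)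
    (h1 : value q α = 1) (hU : q ∉ basesU M) : HighContact q α := by
  by_contra hh
  exact hU ((mem_basesU_iff hq hqM).2 ⟨α, h1, hα.strictOrbit hh
    fun hl => hh (hα.highContact_of_lowContact hq hqM h1 hl)⟩)

lemma LaxOrbit.exists_greedy (hq : 1 < q) (hqM : q < M + 1) (hα : LaxOrbit q α)
    (h1 : value q α = 1) (hh : HighContact q α) :
    ∃ (β : DigitSeq M) (N : ℕ), IsGreedyExpansion q 1 β ∧ LastNonzeroAt β N := by
  classical
  have h0 : 0 < q := by linarith
  obtain ⟨hN, hN1⟩ := Nat.find_spec hh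
  -- The greedy expansion follows α up to the first high contact, where the tail of value 1 is
  -- traded for one unit of the last digit. Being the first contact is what makes the result
  -- lexicographically largest.
  set N := Nat.find hh with hNdef
  let k : Fin (M + 1) := ⟨α N + 1, by omega⟩
  let d : DigitSeq M := splice (fun _ => k) 1 (fun _ => 0)
  have hd0 : d 0 = k := splice_of_lt _ _ Nat.zero_lt_one
  have hd : ∀ i, d (1 + i) = 0 := splice_add _ _ 1
  let β := splice α N d
  have hβN : β N = k := (splice_add α d N 0).trans hd0
  have hβ0 : ∀ i, N < i → β i = 0 := by
    intro i hi
    obtain ⟨j, rfl⟩ := Nat.exists_eq_add_of_lt hi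
    rw [add_assoc, add_comm j]
    exact (splice_add α d N _).trans (hd j)
  have hβt : ∀ i, N ≤ i → tailValue q β (i + 1) = 0 := fun i hi =>
    (tailValue_eq_zero_iff hq β _).2 fun j => hβ0 _ (by omega)
  have hd1 : value q d = tailValue q α N := by
    have h2 := hβt N le_rfl
    rw [tailValue_succ hq, hβN, show tailValue q β N = value q d from
      (tailValue_splice_add α d N 0).trans (tailValue_zero d)] at h2
    rw [tailValue_succ hq] at hN1
    have hk : ((k : ℕ) : ℝ) = (α N : ℕ) + 1 := by simp [k]
    rw [hk] at h2
    have h3 : q * (value q d - tailValue q α N) = 0 := by linarith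
    rcases mul_eq_zero.1 h3 with h4 | h4 <;> linarith
  have hβα : ∀ i ≤ N, tailValue q β i = tailValue q α i := by
    intro i hi
    have h2 := tailValue_splice_of_le hq α d hi
    rw [hd1, sub_self] at h2
    rcases mul_eq_zero.1 h2.symm with h4 | h4
    · exact absurd h4 (pow_pos h0 _).ne'
    · exact sub_eq_zero.1 h4
  have hβv : value q β = 1 := by
    rw [← tailValue_zero, hβα 0 (Nat.zero_le _), tailValue_zero, h1]
  refine ⟨β, N, ⟨hβv, fun e he => ?_⟩, ?_, hβ0⟩
  · by_contra hlt
    obtain ⟨i, hi, hlt⟩ : toLex β < toLex e := not_le.1 hlt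
    have hlt' : (β i : ℕ) < (e i : ℕ) := hlt
    have h2 := tailValue_sub_of_agree hq β e 0 0 i (fun j hj => by simpa using hi j (by omega))
    rw [zero_add, tailValue_zero, tailValue_zero, hβv, show value q e = 1 from he, sub_self,
      mul_zero] at h2
    have h3 := tailValue_succ hq β i
    have h4 := tailValue_succ hq e i
    have h5 := tailValue_nonneg hq e (i + 1)
    have h6 : ((β i : ℕ) : ℝ) + 1 ≤ (e i : ℕ) := by exact_mod_cast hlt'
    have h7 : tailValue q e i = tailValue q β i := by linarith
    rw [h7] at h4
    -- A larger expansion first differing before N would force a high contact of α before N; from N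
    -- on it would need a negative tail value.
    rcases lt_or_ge i N with hiN | hiN
    · have h8 : β i = α i := splice_of_lt _ _ hiN
      have h9 := hα.tailValue_le_one hq hqM h1 (i + 1)
      rw [hβα (i + 1) hiN] at h3
      refine Nat.find_min hh hiN ⟨?_, by linarith⟩
      have := digit_le_nat e i
      rw [← h8]
      omega
    · rw [hβt i hiN] at h3
      linarith
  · rw [hβN]
    exact fun h => by simpa [k] using congrArg Fin.val h

end LaxExpansionOfOne

/-! ### The points `a_i`, `b_i` and the vertices of the graph -/

lemma IsGreedyExpansion.unique {x : ℝ} {β γ : DigitSeq M} (hβ : IsGreedyExpansion q x β)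
    (hγ : IsGreedyExpansion q x γ) : β = γ :=
  toLex.injective (le_antisymm (hγ.2 β hβ.1) (hβ.2 γ hγ.1))

lemma LastNonzeroAt.unique {β : DigitSeq M} {m n : ℕ} (hm : LastNonzeroAt β m)
    (hn : LastNonzeroAt β n) : m = n := by
  rcases lt_trichotomy m n with h | h | h
  · exact absurd (hm.2 n h) hn.1
  · exact h
  · exact absurd (hn.2 m h) hm.1

lemma pointsA_eq {β : DigitSeq M} {N : ℕ} (hβ : IsGreedyExpansion q 1 β)
    (hN : LastNonzeroAt β N) : pointsA M q = (tailValue q β) '' Set.Iic N := by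
  ext y
  constructor
  · rintro ⟨γ, m, hγ, hm, i, hi, rfl⟩
    obtain rfl := hγ.unique hβ
    obtain rfl := hm.unique hN
    exact ⟨i, hi, rfl⟩
  · rintro ⟨i, hi, rfl⟩
    exact ⟨β, N, hβ, hN, i, hi, rfl⟩

lemma pointsA_finite : (pointsA M q).Finite := by
  by_cases h : ∃ (β : DigitSeq M) (N : ℕ), IsGreedyExpansion q 1 β ∧ LastNonzeroAt β N
  · obtain ⟨β, N, hβ, hN⟩ := h
    rw [pointsA_eq hβ hN]
    exact (Set.finite_Iic N).image _
  · convert Set.finite_empty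
    refine Set.eq_empty_of_forall_notMem ?_
    rintro y ⟨β, N, hβ, hN, -⟩
    exact h ⟨β, N, hβ, hN⟩

lemma pointsB_eq : pointsB M q = (fun a => maxValue M q - a) '' pointsA M q := by
  ext y
  constructor
  · rintro ⟨a, ha, rfl⟩
    exact ⟨a, ha, rfl⟩
  · rintro ⟨a, ha, rfl⟩
    exact ⟨a, ha, rfl⟩

lemma pointsB_finite : (pointsB M q).Finite := by
  rw [pointsB_eq]
  exact pointsA_finite.image _

lemma pointsA_subset (hq : 1 < q) : pointsA M q ⊆ Set.Icc 0 (maxValue M q) := by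
  rintro y ⟨β, N, -, -, i, -, rfl⟩
  exact ⟨tailValue_nonneg hq _ _, tailValue_le hq _ _⟩

lemma exists_digit_pointsA (hq : 1 < q) {a : ℝ} (ha : a ∈ pointsA M q) :
    ∃ k : Fin (M + 1), q * a - (k : ℕ) = 0 ∨ q * a - (k : ℕ) ∈ pointsA M q := by
  obtain ⟨β, N, hβ, hN, i, hi, rfl⟩ := ha
  refine ⟨β i, ?_⟩
  rw [← tailValue_succ hq]
  rcases hi.lt_or_eq with h | rfl
  · exact Or.inr ⟨β, N, hβ, hN, i + 1, h, rfl⟩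
  · exact Or.inl ((tailValue_eq_zero_iff hq β _).2 fun j => hN.2 _ (by omega))

/-- The finite set of points `a_i`, `b_i`, `0`, `M / (q - 1)` is mapped into itself. -/
lemma exists_digit_of_mem_points (hq : 1 < q) {z : ℝ} (hz : z ∈ pointsA M q ∪ pointsB M q) :
    ∃ k : Fin (M + 1), q * z - (k : ℕ) ∈ Set.Icc 0 (maxValue M q) ∧
      (q * z - (k : ℕ) = 0 ∨ q * z - (k : ℕ) = maxValue M q ∨
        q * z - (k : ℕ) ∈ pointsA M q ∪ pointsB M q) := by
  have hK := maxValue_nonneg (M := M) hq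
  have hA : ∀ a ∈ pointsA M q, ∃ k : Fin (M + 1), q * a - (k : ℕ) ∈ Set.Icc 0 (maxValue M q) ∧
      (q * a - (k : ℕ) = 0 ∨ q * a - (k : ℕ) ∈ pointsA M q) := by
    intro a ha
    obtain ⟨k, hk⟩ := exists_digit_pointsA hq ha
    refine ⟨k, ?_, hk⟩
    rcases hk with hk | hk
    · rw [hk]
      exact ⟨le_rfl, hK⟩
    · exact pointsA_subset hq hk
  rcases hz with hz | hz
  · obtain ⟨k, h1, h2⟩ := hA z hz
    exact ⟨k, h1, h2.imp_right fun h => Or.inr (Or.inl h)⟩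
  · rw [pointsB_eq] at hz ⊢
    obtain ⟨a, ha, rfl⟩ := hz
    obtain ⟨k, h1, h2⟩ := hA a ha
    have hk : (((Fin.rev k : Fin (M + 1)) : ℕ) : ℝ) = M - (k : ℕ) := by
      rw [Fin.val_rev, Nat.succ_sub_succ, Nat.cast_sub (Nat.lt_succ_iff.1 k.isLt)]
    have he : q * (maxValue M q - a) - ((Fin.rev k : Fin (M + 1)) : ℕ) =
        maxValue M q - (q * a - (k : ℕ)) := by
      rw [hk]
      linear_combination mul_maxValue (M := M) hq
    refine ⟨Fin.rev k, ?_, ?_⟩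
    · rw [he]
      constructor <;> linarith [h1.1, h1.2]
    · rw [he]
      rcases h2 with h2 | h2
      · right; left; linarith
      · right; right; right; exact ⟨_, h2, rfl⟩

lemma one_mem_pointsA (h : ∃ (β : DigitSeq M) (N : ℕ), IsGreedyExpansion q 1 β ∧
    LastNonzeroAt β N) : 1 ∈ pointsA M q := by
  obtain ⟨β, N, hβ, hN⟩ := h
  exact ⟨β, N, hβ, hN, 0, Nat.zero_le _, by rw [tailValue_zero]; exact hβ.1.symm⟩

lemma mem_switchRegion_iff (hq : 1 < q) {x : ℝ} :
    x ∈ switchRegion M q ↔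
      ∃ j : ℕ, j ∈ Set.Icc 1 M ∧ (j : ℝ) ≤ q * x ∧ q * x ≤ j - 1 + maxValue M q := by
  have h0 : 0 < q := by linarith
  have hK : (M : ℝ) / (q ^ 2 - q) = maxValue M q / q := by
    have : q - 1 ≠ 0 := by linarith
    rw [show q ^ 2 - q = (q - 1) * q by ring, maxValue, div_div]
  simp only [switchRegion, Set.mem_iUnion, Set.mem_Icc, hK, ← add_div, div_le_iff₀ h0,
    le_div_iff₀ h0, exists_prop, mul_comm x q]

lemma mem_vertexRegion_iff {x : ℝ} : x ∈ vertexRegion M q ↔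
    x ∈ Set.Ioo 0 (maxValue M q) ∧ x ∉ switchRegion M q ∧ x ∉ pointsA M q ∪ pointsB M q := by
  simp only [vertexRegion, Set.mem_sdiff, Set.mem_union, not_or]
  rfl

lemma subset_vertexRegion_of_mem_vertices {I : Set ℝ} (hI : I ∈ vertices M q) :
    I ⊆ vertexRegion M q := by
  obtain ⟨x, -, rfl⟩ := hI
  exact connectedComponentIn_subset _ _

lemma nonempty_of_mem_vertices {I : Set ℝ} (hI : I ∈ vertices M q) : I.Nonempty := by
  obtain ⟨x, hx, rfl⟩ := hI
  exact ⟨x, mem_connectedComponentIn hx⟩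

/-- Points of the vertex region have a single admissible digit. -/
lemma digit_bounds_of_mem_vertexRegion (hq : 1 < q) {z y : ℝ} (hz : z ∈ vertexRegion M q)
    {k : ℕ} (hkM : k ≤ M) (hy : y ∈ Set.Ioo 0 (maxValue M q)) (hzy : q * z - k = y) :
    (k < M → y < 1) ∧ (0 < k → maxValue M q - 1 < y) := by
  have hS := (mem_vertexRegion_iff.1 hz).2.1
  rw [mem_switchRegion_iff hq] at hS
  constructor
  · intro hk
    by_contra! h
    refine hS ⟨k + 1, ⟨by omega, by omega⟩, ?_, ?_⟩
    · push_cast; linarith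
    · push_cast; linarith [hy.2]
  · intro hk
    by_contra! h
    refine hS ⟨k, ⟨by omega, by omega⟩, ?_, ?_⟩
    · linarith [hy.1]
    · linarith

lemma IsEdge.bounds (hq : 1 < q) {I J : Set ℝ} {k : Fin (M + 1)} (h : IsEdge M q I k J) {y : ℝ}
    (hy : y ∈ J) : ((k : ℕ) < M → y < 1) ∧ (0 < (k : ℕ) → maxValue M q - 1 < y) := by
  obtain ⟨z, hz, hzy⟩ := h.2.2 hy
  exact digit_bounds_of_mem_vertexRegion hq (subset_vertexRegion_of_mem_vertices h.1 hz)
    (Nat.lt_succ_iff.1 k.isLt)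
    (mem_vertexRegion_iff.1 (subset_vertexRegion_of_mem_vertices h.2.1 hy)).1 hzy

/-! ### Label sequences of paths are lax -/

/-- Points can be pulled back along a path. -/
lemma exists_pullback (hq : 1 < q) {c : DigitSeq M} {I : ℕ → Set ℝ}
    (hI : ∀ n, IsEdge M q (I n) (c n) (I (n + 1))) (n l : ℕ) {y : ℝ} (hy : y ∈ I (n + l)) :
    ∃ z ∈ I n, y - tailValue q c (n + l) = q ^ l * (z - tailValue q c n) := by
  induction l generalizing y with
  | zero => exact ⟨y, hy, by simp⟩
  | succ l ih =>
    obtain ⟨x, hx, hxy⟩ := (hI (n + l)).2.2 hy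
    obtain ⟨z, hz, hzx⟩ := ih hx
    refine ⟨z, hz, ?_⟩
    dsimp only at hxy
    rw [← add_assoc, tailValue_succ hq, pow_succ, ← hxy]
    linear_combination q * hzx

/-- Pulling back `l` steps contracts distances to the orbit by q^l, so each tail value is in the
closure of the vertex at that time. -/
lemma exists_mem_near_tailValue (hq : 1 < q) {c : DigitSeq M} {I : ℕ → Set ℝ}
    (hI : ∀ n, IsEdge M q (I n) (c n) (I (n + 1))) (n : ℕ) {ε : ℝ} (hε : 0 < ε) :
    ∃ z ∈ I n, |z - tailValue q c n| < ε := by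
  obtain ⟨l, hl⟩ := pow_unbounded_of_one_lt (maxValue M q / ε) hq
  obtain ⟨y, hy⟩ := nonempty_of_mem_vertices (hI (n + l)).1
  obtain ⟨z, hz, hyz⟩ := exists_pullback hq hI n l hy
  refine ⟨z, hz, ?_⟩
  have h1 := (mem_vertexRegion_iff.1 (subset_vertexRegion_of_mem_vertices (hI (n + l)).1 hy)).1
  have h2 := tailValue_nonneg hq c (n + l)
  have h3 := tailValue_le hq c (n + l)
  have h4 : |y - tailValue q c (n + l)| ≤ maxValue M q := by
    rw [abs_le]
    constructor <;> linarith [h1.1, h1.2]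
  have hp : 0 < q ^ l := pow_pos (by linarith) l
  rw [hyz, abs_mul, abs_of_pos hp] at h4
  rw [div_lt_iff₀ hε] at hl
  by_contra! h5
  have := mul_le_mul_of_nonneg_left h5 hp.le
  linarith

lemma laxOrbit_of_mem_seqG (hq : 1 < q) {c : DigitSeq M} (hc : c ∈ seqG M q) :
    LaxOrbit q c := by
  obtain ⟨I, hI⟩ := hc
  intro n
  constructor
  · intro hn
    by_contra! h
    obtain ⟨z, hz, hzn⟩ := exists_mem_near_tailValue hq hI (n + 1) (sub_pos.2 h)
    have := ((hI n).bounds hq hz).1 hn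
    have := (abs_lt.1 hzn).1
    linarith
  · intro hn
    by_contra! h
    obtain ⟨z, hz, hzn⟩ := exists_mem_near_tailValue hq hI (n + 1) (sub_pos.2 h)
    have := ((hI n).bounds hq hz).2 hn
    have := (abs_lt.1 hzn).2
    linarith

/-- Path points right after the high contact lie below 1. From there `c` follows α, so their images
at the low contact of α lie below K-1; but the digit before is non-zero and forces them above K-1.
-/
lemma not_highContact_of_mem_seqG (hq : 1 < q) (hqM : q < M + 1) {α : DigitSeq M}
    (hα : LaxOrbit q α) (h1 : value q α = 1) (hl : LowContact q α) {c : DigitSeq M}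
    (hc : c ∈ seqG M q) : ¬ HighContact q c := by
  have hlax := laxOrbit_of_mem_seqG hq hc
  obtain ⟨I, hI⟩ := hc
  rintro ⟨n, hn, hn1⟩
  obtain ⟨j, hj, hj1⟩ := hl
  obtain ⟨y, hy⟩ := nonempty_of_mem_vertices (hI (n + 1 + (j + 1))).1
  obtain ⟨z, hz, hyz⟩ := exists_pullback hq hI (n + 1) (j + 1) hy
  have h2 := ((hI n).bounds hq hz).1 hn
  have h3 := ((hI (n + 1 + j)).bounds hq hy).2
    (by rw [hα.tail_eq hq hqM h1 hlax hn1]; exact hj)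
  rw [hn1, hα.tailValue_add hq hqM h1 hlax hn1, hj1] at hyz
  have : q ^ (j + 1) * (z - 1) < 0 := mul_neg_of_pos_of_neg (pow_pos (by linarith) _) (by linarith)
  linarith

/-! ### Reflection symmetry and the Markov property -/

lemma switchRegion_reflect (hq : 1 < q) {x : ℝ} (hx : x ∈ switchRegion M q) :
    maxValue M q - x ∈ switchRegion M q := by
  rw [mem_switchRegion_iff hq] at hx ⊢
  obtain ⟨j, ⟨hj1, hjM⟩, h1, h2⟩ := hx
  have hK := mul_maxValue (M := M) hq
  refine ⟨M + 1 - j, ⟨by omega, by omega⟩, ?_, ?_⟩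
  · rw [Nat.cast_sub (by omega)]; push_cast; linarith
  · rw [Nat.cast_sub (by omega)]; push_cast; linarith

lemma points_reflect {x : ℝ} (hx : x ∈ pointsA M q ∪ pointsB M q) :
    maxValue M q - x ∈ pointsA M q ∪ pointsB M q := by
  rw [pointsB_eq] at hx ⊢
  rcases hx with h | ⟨a, ha, rfl⟩
  · exact Or.inr ⟨x, h, rfl⟩
  · left
    simpa using ha

lemma vertexRegion_reflect (hq : 1 < q) {x : ℝ} (hx : x ∈ vertexRegion M q) :
    maxValue M q - x ∈ vertexRegion M q := by
  rw [mem_vertexRegion_iff] at hx ⊢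
  obtain ⟨⟨h1, h2⟩, h3, h4⟩ := hx
  refine ⟨⟨by linarith, by linarith⟩, fun h => h3 ?_, fun h => h4 ?_⟩
  · simpa using switchRegion_reflect hq h
  · simpa using points_reflect h

lemma image_vertexRegion (hq : 1 < q) :
    (fun x => maxValue M q - x) '' vertexRegion M q = vertexRegion M q := by
  ext x
  constructor
  · rintro ⟨y, hy, rfl⟩
    exact vertexRegion_reflect hq hy
  · intro hx
    exact ⟨maxValue M q - x, vertexRegion_reflect hq hx, by simp⟩

lemma vertices_reflect (hq : 1 < q) {I : Set ℝ} (hI : I ∈ vertices M q) :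
    (fun x => maxValue M q - x) '' I ∈ vertices M q := by
  obtain ⟨x, hx, rfl⟩ := hI
  refine ⟨maxValue M q - x, vertexRegion_reflect hq hx, ?_⟩
  have h := (Homeomorph.subLeft (maxValue M q)).image_connectedComponentIn hx
  simp only [Homeomorph.coe_subLeft] at h
  rw [h, image_vertexRegion hq]

lemma seqG_reflection (hq : 1 < q) {c : DigitSeq M} (hc : c ∈ seqG M q) :
    reflection c ∈ seqG M q := by
  obtain ⟨I, hI⟩ := hc
  refine ⟨fun n => (fun x => maxValue M q - x) '' I n, fun n =>
    ⟨vertices_reflect hq (hI n).1, vertices_reflect hq (hI n).2.1, ?_⟩⟩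
  rintro y ⟨x, hx, rfl⟩
  obtain ⟨z, hz, rfl⟩ := (hI n).2.2 hx
  refine ⟨_, ⟨z, hz, rfl⟩, ?_⟩
  simp only [reflection_cast]
  linear_combination mul_maxValue (M := M) hq

/-- The Markov property: the image of a vertex under its digit map contains each vertex that it
meets. -/
lemma isEdge_of_meet (hq : 1 < q) (h1 : 1 ∈ pointsA M q) {I J : Set ℝ} (hI : I ∈ vertices M q)
    (hJ : J ∈ vertices M q) {k : Fin (M + 1)} {p : ℝ} (hp : p ∈ I) (hpJ : q * p - (k : ℕ) ∈ J) :
    IsEdge M q I k J := by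
  have h0 : 0 < q := by linarith
  have hK := mul_maxValue (M := M) hq
  have hkM : (k : ℕ) ≤ M := Nat.lt_succ_iff.1 k.isLt
  have hJR := subset_vertexRegion_of_mem_vertices hJ
  have hJconn : IsPreconnected J := by
    obtain ⟨x, -, rfl⟩ := hJ
    exact isPreconnected_connectedComponentIn
  have hpts : ∀ y ∈ J, y ∉ pointsA M q ∪ pointsB M q := fun y hy =>
    (mem_vertexRegion_iff.1 (hJR hy)).2.2
  have hb1 : maxValue M q - 1 ∈ pointsA M q ∪ pointsB M q := by
    rw [pointsB_eq]
    exact Or.inr ⟨1, h1, rfl⟩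
  have hJI : ∀ y ∈ J, y ∈ Set.Ioo 0 (maxValue M q) := fun y hy =>
    (mem_vertexRegion_iff.1 (hJR hy)).1
  have hpb := digit_bounds_of_mem_vertexRegion hq (subset_vertexRegion_of_mem_vertices hI hp) hkM
    (hJI _ hpJ) rfl
  -- `J` is an interval avoiding 1 and K-1, so the bounds valid at one of its points hold on all of
  -- it.
  have hord := hJconn.ordConnected
  have hub : (k : ℕ) < M → ∀ y ∈ J, y < 1 := by
    intro hk y hy
    by_contra! h
    exact hpts 1 (hord.out hpJ hy ⟨(hpb.1 hk).le, h⟩) (Or.inl h1)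
  have hlb : 0 < (k : ℕ) → ∀ y ∈ J, maxValue M q - 1 < y := by
    intro hk y hy
    by_contra! h
    exact hpts _ (hord.out hy hpJ ⟨h, (hpb.2 hk).le⟩) hb1
  let g : ℝ → ℝ := fun y => (y + (k : ℕ)) / q
  have hg : ∀ y, q * g y = y + (k : ℕ) := fun y => mul_div_cancel₀ _ h0.ne'
  have hgR : g '' J ⊆ vertexRegion M q := by
    rintro z ⟨y, hy, rfl⟩
    have hy0 := hJI y hy
    have hkM' : ((k : ℕ) : ℝ) ≤ M := by exact_mod_cast hkM
    rw [mem_vertexRegion_iff]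
    refine ⟨⟨div_pos (by linarith [hy0.1, Nat.cast_nonneg (α := ℝ) (k : ℕ)]) h0, ?_⟩, ?_, ?_⟩
    · by_contra! h
      have := mul_le_mul_of_nonneg_left h h0.le
      rw [hg] at this
      linarith [hy0.2]
    · rw [mem_switchRegion_iff hq]
      rintro ⟨j, ⟨hj1, hjM⟩, h2, h3⟩
      rw [hg] at h2 h3
      rcases Nat.lt_or_ge k j with hj | hj
      · have := hub (by omega) y hy
        have : ((k : ℕ) : ℝ) + 1 ≤ j := by exact_mod_cast hj
        linarith
      · have := hlb (by omega) y hy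
        have : (j : ℝ) ≤ (k : ℕ) := by exact_mod_cast hj
        linarith
    · intro hz
      -- Some digit `d` sends a removed point to a removed point or an endpoint. The bounds on `J`
      -- force d = k, so `y` itself would be such a point.
      obtain ⟨d, hd, hd'⟩ := exists_digit_of_mem_points hq hz
      rw [hg] at hd hd'
      have hdM : (d : ℕ) ≤ M := Nat.lt_succ_iff.1 d.isLt
      have hdk : (d : ℕ) = k := by
        rcases lt_trichotomy (d : ℕ) (k : ℕ) with h | h | h
        · have := hlb (by omega) y hy
          have : ((d : ℕ) : ℝ) + 1 ≤ (k : ℕ) := by exact_mod_cast h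
          linarith [hd.2]
        · exact h
        · have := hub (by omega) y hy
          have : ((k : ℕ) : ℝ) + 1 ≤ (d : ℕ) := by exact_mod_cast h
          linarith [hd.1]
      rw [hdk, add_sub_cancel_right] at hd'
      rcases hd' with h | h | h
      · exact hy0.1.ne' h
      · exact hy0.2.ne h
      · exact hpts y hy h
  refine ⟨hI, hJ, fun y hy => ⟨g y, ?_, by simp only [hg]; ring⟩⟩
  have hgp : p ∈ g '' J := ⟨_, hpJ, by simp only [g]; field_simp; ring⟩
  obtain ⟨x, hx, rfl⟩ := hI
  rw [connectedComponentIn_eq hp]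
  exact (hJconn.image g (by fun_prop)).subset_connectedComponentIn hgp hgR ⟨y, hy, rfl⟩

/-! ### Lax sequences as label sequences -/

/-- The finitely many removed points do not matter on a one-sided germ, and a switch interval
starting at `x` is left at once; only an interval that begins before `x` and reaches it obstructs.
-/
lemma eventually_mem_vertexRegion {x : ℝ} (hq : 1 < q) (hx : 0 < x) (hxK : x ≤ maxValue M q)
    (hS : ∀ j : ℕ, j ∈ Set.Icc 1 M → (j : ℝ) < q * x → ¬ q * x ≤ j - 1 + maxValue M q) :
    ∀ᶠ y in 𝓝[<] x, y ∈ vertexRegion M q := by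
  have h0 : 0 < q := by linarith
  have hlt : ∀ᶠ y in 𝓝[<] x, y < x := self_mem_nhdsWithin
  have hpos : ∀ᶠ y in 𝓝[<] x, 0 < y := (lt_mem_nhds hx).filter_mono nhdsWithin_le_nhds
  have hP : ∀ᶠ y in 𝓝[<] x, y ∉ pointsA M q ∪ pointsB M q := by
    have hf : ((pointsA M q ∪ pointsB M q) \ {x}).Finite :=
      (pointsA_finite.union pointsB_finite).subset Set.sdiff_subset
    have h0 : ∀ᶠ y in 𝓝 x, y ∉ (pointsA M q ∪ pointsB M q) \ {x} :=
      hf.isClosed.compl_mem_nhds (by simp)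
    have h1 := h0.filter_mono (nhdsWithin_le_nhds (s := Set.Iio x))
    filter_upwards [h1, hlt] with y h2 h3 h4
    exact h2 ⟨h4, h3.ne⟩
  have hSw : ∀ᶠ y in 𝓝[<] x, ∀ j ∈ Set.Icc 1 M,
      ¬ ((j : ℝ) ≤ q * y ∧ q * y ≤ j - 1 + maxValue M q) := by
    rw [eventually_all_finite (Set.finite_Icc 1 M)]
    intro j hj
    rcases lt_or_ge (j : ℝ) (q * x) with h | h
    · have h1 : j - 1 + maxValue M q < q * x := not_le.1 (hS j hj h)
      have h2 : ∀ᶠ y in 𝓝 x, j - 1 + maxValue M q < q * y :=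
        (continuous_const.mul continuous_id).continuousAt.eventually (lt_mem_nhds h1)
      filter_upwards [h2.filter_mono nhdsWithin_le_nhds] with y h3 h4
      linarith [h4.2]
    · filter_upwards [hlt] with y hy h4
      have := mul_lt_mul_of_pos_left hy h0
      linarith [h4.1]
  filter_upwards [hlt, hpos, hP, hSw] with y h1 h2 h3 h4
  rw [mem_vertexRegion_iff, mem_switchRegion_iff hq]
  exact ⟨⟨h2, h1.trans_le hxK⟩, fun ⟨j, hj, h5⟩ => h4 j hj h5, h3⟩

lemma LaxOrbit.tailValue_pos (hq : 1 < q) (hqM : q < M + 1) {c : DigitSeq M} (hc : LaxOrbit q c)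
    (hv : 0 < value q c) (n : ℕ) : 0 < tailValue q c n := by
  have hK := one_lt_maxValue hq hqM
  induction n with
  | zero => rwa [tailValue_zero]
  | succ n ih =>
    rcases Nat.eq_zero_or_pos (c n : ℕ) with h | h
    · rw [tailValue_succ hq, h, Nat.cast_zero, sub_zero]
      exact mul_pos (by linarith) ih
    · linarith [(hc n).2 h]

/-- The vertices are the components containing the left germs of the tail values. The digit maps are
increasing, so they carry left germs to left germs, and the Markov property supplies the edges. -/
lemma mem_seqG_of_not_lowContact (hq : 1 < q) (hqM : q < M + 1) (h1 : 1 ∈ pointsA M q)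
    {c : DigitSeq M} (hc : LaxOrbit q c) (hv : 0 < value q c) (hl : ¬ LowContact q c) :
    c ∈ seqG M q := by
  have h0 : 0 < q := by linarith
  have hgerm : ∀ n, ∃ a < tailValue q c n, Set.Ioo a (tailValue q c n) ⊆ vertexRegion M q := by
    intro n
    have hev := eventually_mem_vertexRegion hq (hc.tailValue_pos hq hqM hv n)
      (tailValue_le hq c n) (fun j hj h2 h3 => ?_)
    · exact (mem_nhdsLT_iff_exists_Ioo_subset).1 hev
    -- The upper lax bound gives j ≤ c_n, so the next tail value is at most K-1: a low contact.
    · have h4 := tailValue_succ hq c n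
      have hjc : j ≤ (c n : ℕ) := by
        by_contra! h
        have h5 := (hc n).1 (lt_of_lt_of_le h hj.2)
        have h6 : ((c n : ℕ) : ℝ) + 1 ≤ j := by exact_mod_cast h
        linarith
      have hpos : 0 < (c n : ℕ) := lt_of_lt_of_le hj.1 hjc
      have hjc' : (j : ℝ) ≤ (c n : ℕ) := by exact_mod_cast hjc
      have h5 := (hc n).2 hpos
      exact hl ⟨n, hpos, by linarith⟩
  choose a ha haR using hgerm
  have hmid : ∀ n, (a n + tailValue q c n) / 2 ∈ Set.Ioo (a n) (tailValue q c n) := fun n =>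
    ⟨by linarith [ha n], by linarith [ha n]⟩
  let I : ℕ → Set ℝ := fun n =>
    connectedComponentIn (vertexRegion M q) ((a n + tailValue q c n) / 2)
  have hI : ∀ n, I n ∈ vertices M q := fun n => ⟨_, haR n (hmid n), rfl⟩
  have hsub : ∀ n, Set.Ioo (a n) (tailValue q c n) ⊆ I n := fun n =>
    isPreconnected_Ioo.subset_connectedComponentIn (hmid n) (haR n)
  refine ⟨I, fun n => ?_⟩
  have h2 : max (a n) ((a (n + 1) + (c n : ℕ)) / q) < tailValue q c n := by
    refine max_lt (ha n) ?_
    rw [div_lt_iff₀ h0]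
    have h3 := ha (n + 1)
    rw [tailValue_succ hq] at h3
    linarith
  obtain ⟨p, hp1, hp2⟩ := exists_between h2
  rw [max_lt_iff, div_lt_iff₀ h0] at hp1
  refine isEdge_of_meet hq h1 (hI n) (hI (n + 1)) (hsub n ⟨hp1.1, hp2⟩)
    (hsub (n + 1) ⟨by linarith, ?_⟩)
  rw [tailValue_succ hq]
  have := mul_lt_mul_of_pos_left hp2 h0
  linarith

/-- Left germs serve when there is no low contact, right germs, by reflection, when there is no high
contact. The zero sequence has no left germ and takes the second route. -/
lemma mem_seqG_of_not_contact (hq : 1 < q) (hqM : q < M + 1) (h1 : 1 ∈ pointsA M q)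
    {c : DigitSeq M} (hc : LaxOrbit q c) (h : ¬ (HighContact q c ∧ LowContact q c)) :
    c ∈ seqG M q := by
  have hK := one_lt_maxValue hq hqM
  have hrefl : ¬ HighContact q c → value q c < maxValue M q → c ∈ seqG M q := by
    intro hh hv
    rw [← reflection_reflection c]
    refine seqG_reflection hq (mem_seqG_of_not_lowContact hq hqM h1 (hc.reflect hq) ?_ ?_)
    · rw [value_reflection hq]
      linarith
    · rwa [lowContact_reflection hq]
  have hzero : ∀ d : DigitSeq M, value q d = 0 → ¬ HighContact q d := by
    rintro d hd ⟨n, -, hn⟩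
    rw [← tailValue_zero, tailValue_eq_zero_iff hq] at hd
    have := (tailValue_eq_zero_iff hq d (n + 1)).2 fun k => by simpa using hd (n + 1 + k)
    linarith
  rcases (value_nonneg hq c).eq_or_lt with hv | hv
  · exact hrefl (hzero c hv.symm) (by linarith)
  · by_cases hl : LowContact q c
    · refine hrefl (fun hh => h ⟨hh, hl⟩) ((value_le hq c).lt_of_ne fun hv' => ?_)
      refine hzero (reflection c) ?_ ((highContact_reflection hq).2 hl)
      rw [value_reflection hq, hv', sub_self]
    · exact mem_seqG_of_not_lowContact hq hqM h1 hc hv hl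

/-- After the earlier contact `c` is α or its reflection, so the later, opposite contact would be a
low contact of α. Simultaneous contacts would give K = 2, whereas K-1 < 1. -/
lemma LaxOrbit.not_contact (hq : 1 < q) (hqM : q < M + 1) {α : DigitSeq M} (hα : LaxOrbit q α)
    (h1 : value q α = 1) (hl : ¬ LowContact q α) {c : DigitSeq M} (hc : LaxOrbit q c) :
    ¬ (HighContact q c ∧ LowContact q c) := by
  rintro ⟨⟨m, hm, hm1⟩, ⟨n, hn, hn1⟩⟩
  rcases lt_trichotomy m n with h | rfl | h
  · obtain ⟨j, rfl⟩ := Nat.exists_eq_add_of_lt h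
    rw [show m + j + 1 = m + 1 + j by ring] at hn hn1
    rw [hα.tail_eq hq hqM h1 hc hm1] at hn
    rw [add_assoc, hα.tailValue_add hq hqM h1 hc hm1] at hn1
    exact hl ⟨j, hn, hn1⟩
  · have h2 := hα.lt_tailValue hq hqM h1 hl 0
    rw [tailValue_zero, h1] at h2
    linarith
  · obtain ⟨j, rfl⟩ := Nat.exists_eq_add_of_lt h
    rw [show n + j + 1 = n + 1 + j by ring] at hm hm1
    rw [hα.tail_eq_reflection hq hqM h1 hc hn1, reflection_apply] at hm
    rw [add_assoc, hα.tailValue_add_reflection hq hqM h1 hc hn1] at hm1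
    exact hl ⟨j, by omega, by linarith⟩

/-! ### Closed sets of lax and strict orbits -/

lemma isClosed_setOf_laxOrbit (hq : 1 < q) : IsClosed {c : DigitSeq M | LaxOrbit q c} := by
  have hp : ∀ n (p : Fin (M + 1) → Prop), IsOpen {c : DigitSeq M | p (c n)} := fun n p =>
    (isOpen_discrete {d | p d}).preimage (continuous_apply n)
  simp only [LaxOrbit, Set.ofPred_forall, Set.ofPred_and]
  exact isClosed_iInter fun n =>
    (isClosed_imp (hp n fun d => (d : ℕ) < M)
      (isClosed_le (continuous_tailValue hq (n + 1)) continuous_const)).inter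
    (isClosed_imp (hp n fun d => 0 < (d : ℕ))
      (isClosed_le continuous_const (continuous_tailValue hq (n + 1))))

lemma exists_agree_of_mem_closure {S : Set (DigitSeq M)} {c : DigitSeq M} (hc : c ∈ closure S)
    (L : ℕ) : ∃ e ∈ S, ∀ k < L, e k = c k := by
  have hopen : IsOpen (Set.pi (Set.Iio L) (fun k => ({c k} : Set (Fin (M + 1))))) :=
    isOpen_set_pi (Set.finite_Iio L) fun k _ => isOpen_discrete _
  obtain ⟨e, he, heS⟩ := mem_closure_iff.1 hc _ hopen (fun k _ => rfl)
  exact ⟨e, heS, fun k hk => he k hk⟩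

/-- The mechanism that forbids high contacts on paths: a strict orbit agreeing long enough is below
1 at the contact, hence below K-1 at the low contact of α. -/
lemma LaxOrbit.not_highContact_of_approx (hq : 1 < q) (hqM : q < M + 1) {α c : DigitSeq M}
    (hα : LaxOrbit q α) (h1 : value q α = 1) (hl : LowContact q α) (hc : LaxOrbit q c)
    (happ : ∀ L, ∃ e : DigitSeq M, StrictOrbit q e ∧ ∀ k < L, e k = c k) :
    ¬ HighContact q c := by
  rintro ⟨n, hn, hn1⟩
  obtain ⟨j, hj, hj1⟩ := hl
  obtain ⟨e, he, hec⟩ := happ (n + 1 + (j + 1))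
  have h2 := (he n).1 (by rw [hec n (by omega)]; exact hn)
  have h3 := (he (n + 1 + j)).2
    (by rw [hec _ (by omega), hα.tail_eq hq hqM h1 hc hn1]; exact hj)
  have h4 := tailValue_sub_of_agree hq c e (n + 1) (n + 1) (j + 1)
    fun k hk => (hec _ (by omega)).symm
  rw [hα.tailValue_add hq hqM h1 hc hn1, hj1, hn1] at h4
  have : q ^ (j + 1) * (tailValue q e (n + 1) - 1) < 0 :=
    mul_neg_of_pos_of_neg (pow_pos (by linarith) _) (by linarith)
  rw [add_assoc] at h3
  linarith

lemma isClosed_setOf_strictOrbit (hq : 1 < q) (hqM : q < M + 1) {α : DigitSeq M}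
    (hα : LaxOrbit q α) (h1 : value q α = 1) (hl : LowContact q α) :
    IsClosed {c : DigitSeq M | StrictOrbit q c} := by
  refine isClosed_of_closure_subset fun c hc => ?_
  have hlax : LaxOrbit q c := closure_minimal (s := {c : DigitSeq M | StrictOrbit q c})
    (fun d (hd : StrictOrbit q d) => hd.lax) (isClosed_setOf_laxOrbit hq) hc
  have happ := fun L => exists_agree_of_mem_closure hc L
  refine hlax.strictOrbit (hα.not_highContact_of_approx hq hqM h1 hl hlax happ) ?_
  rw [← highContact_reflection hq]
  refine hα.not_highContact_of_approx hq hqM h1 hl (hlax.reflect hq) fun L => ?_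
  obtain ⟨e, he, hec⟩ := happ L
  exact ⟨reflection e, StrictOrbit.reflect hq he, fun k hk => by simp [reflection, hec k hk]⟩

lemma isClosed_image_value (hq : 1 < q) {S : Set (DigitSeq M)} (hS : IsClosed S) :
    IsClosed (value q '' S) := by
  have h : Continuous (value (M := M) q) := by
    simpa only [tailValue_zero] using continuous_tailValue (M := M) hq 0
  exact (hS.isCompact.image h).isClosed

/-! ### Limits of bases in 𝒰 -/

lemma basesU_subset (hM : 1 ≤ M) : basesU M ⊆ Set.Icc (1 + (M : ℝ) / 2) (M + 1) := by
  intro q hU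
  have hM' : (1 : ℝ) ≤ M := by exact_mod_cast hM
  obtain ⟨⟨hq, hqM⟩, -⟩ := id hU
  refine ⟨?_, hqM⟩
  rcases hqM.eq_or_lt with rfl | hqM
  · linarith
  · obtain ⟨α, h1, hα⟩ := (mem_basesU_iff hq hqM).1 hU
    have h2 := hα.lax.maxValue_le_two hq hqM h1
    rw [maxValue, div_le_iff₀ (by linarith)] at h2
    linarith

/-- A unique expansion of `1` does not begin with a word followed by its reflection. -/
lemma not_agree_of_reflected {r : ℝ} (hr : 1 < r) {e α : DigitSeq M} (hes : StrictOrbit r e)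
    (he1 : value r e = 1) {n : ℕ} (hn : 0 < (α n : ℕ))
    (hrefl : ∀ k, α (n + 1 + k) = reflection α k) (hk : ∀ i < 2 * n + 2, e i = α i) : False := by
  have h2 := (hes n).2 (by rw [hk n (by omega)]; exact hn)
  have h3 := (hes (n + 1 + n)).1 (by
    rw [hk _ (by omega), hrefl, reflection_apply]
    have := digit_le_nat α n
    omega)
  -- With δ = t(n+1) - (K-1) > 0 for the tail values t of `e` in base `r`, this reads t(2n+2) - 1 =
  -- (r^(n+1) - 1)δ > 0, contrary to `h3`.
  have h4 := tailValue_sub_of_agree hr (reflection e) e 0 (n + 1) (n + 1) fun i hi => by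
    rw [hk _ (by omega), hrefl, zero_add]
    simp [reflection, hk i (by omega)]
  rw [zero_add, tailValue_reflection hr, tailValue_reflection hr, tailValue_zero, he1] at h4
  rw [add_assoc (n + 1) n 1] at h3
  have h5 : 1 < r ^ (n + 1) := one_lt_pow₀ hr (by omega)
  nlinarith

lemma tendsto_tailValue (hq : 1 < q) {s : ℕ → ℝ} {γ : ℕ → DigitSeq M} {α : DigitSeq M}
    (hs : Tendsto s atTop (𝓝 q)) (hγ : Tendsto γ atTop (𝓝 α)) (n : ℕ) :
    Tendsto (fun k => tailValue (s k) (γ k) n) atTop (𝓝 (tailValue q α n)) := by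
  have h := hs.prodMk_nhds hγ
  exact Tendsto.comp (g := fun p : ℝ × DigitSeq M => tailValue p.1 p.2 n)
    (f := fun k => (s k, γ k)) (continuousAt_tailValue hq α n) h

/-- By compactness, expansions of 1 in bases of 𝒰 tending to q subconverge to some α, and strict
inequalities become weak. A low contact of α would show in finitely many digits, which the
approximating expansions share. -/
lemma exists_of_mem_closure_basesU (hM : 1 ≤ M) (hcl : q ∈ closure (basesU M))
    (hU : q ∉ basesU M) : 1 < q ∧ q < M + 1 ∧
      ∃ α : DigitSeq M, LaxOrbit q α ∧ value q α = 1 ∧ ¬ LowContact q α := by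
  have hM' : (1 : ℝ) ≤ M := by exact_mod_cast hM
  obtain ⟨hq', hqM'⟩ := closure_minimal (basesU_subset hM) isClosed_Icc hcl
  have hq : 1 < q := by linarith
  have hqM : q < M + 1 := hqM'.lt_of_ne fun h => hU (h ▸ succ_mem_basesU hM)
  refine ⟨hq, hqM, ?_⟩
  obtain ⟨s, hs, hsq⟩ := mem_closure_iff_seq_limit.1 hcl
  obtain ⟨n₀, hn₀⟩ := eventually_atTop.1
    ((hsq.eventually (lt_mem_nhds hq)).and (hsq.eventually (gt_mem_nhds hqM)))
  have hγ : ∀ n, ∃ γ : DigitSeq M, value (s (n₀ + n)) γ = 1 ∧ StrictOrbit (s (n₀ + n)) γ :=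
    fun n => (mem_basesU_iff (hn₀ _ (by omega)).1 (hn₀ _ (by omega)).2).1 (hs _)
  choose γ hγ1 hγs using hγ
  obtain ⟨α, φ, hφ, hlim⟩ := CompactSpace.tendsto_subseq γ
  have hbase : Tendsto (fun n => s (n₀ + φ n)) atTop (𝓝 q) :=
    hsq.comp (tendsto_atTop_mono (fun n => Nat.le_add_left _ n₀) hφ.tendsto_atTop)
  have htail : ∀ n, Tendsto (fun k => tailValue (s (n₀ + φ k)) (γ (φ k)) n) atTop
      (𝓝 (tailValue q α n)) :=
    tendsto_tailValue hq hbase hlim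
  have hmax : Tendsto (fun k => maxValue M (s (n₀ + φ k))) atTop (𝓝 (maxValue M q)) :=
    Tendsto.comp (g := maxValue M) (continuousAt_maxValue hq) hbase
  have hdig : ∀ n, ∀ᶠ k in atTop, γ (φ k) n = α n := fun n =>
    (tendsto_pi_nhds.1 hlim n).eventually ((isOpen_discrete {α n}).mem_nhds rfl)
  have h1 : value q α = 1 := by
    rw [← tailValue_zero]
    refine tendsto_nhds_unique (htail 0) ?_
    simp only [tailValue_zero, hγ1, tendsto_const_nhds]
  have hlax : LaxOrbit q α := by
    intro n
    constructor
    · intro hn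
      refine le_of_tendsto (htail (n + 1)) ?_
      filter_upwards [hdig n] with k hk
      exact ((hγs (φ k) n).1 (hk ▸ hn)).le
    · intro hn
      refine le_of_tendsto_of_tendsto (hmax.sub_const 1) (htail (n + 1)) ?_
      filter_upwards [hdig n] with k hk
      exact ((hγs (φ k) n).2 (hk ▸ hn)).le
  refine ⟨α, hlax, h1, ?_⟩
  rintro ⟨n, hn, hn1⟩
  have hall : ∀ᶠ k in atTop, ∀ i ∈ Set.Iio (2 * n + 2), γ (φ k) i = α i := by
    rw [eventually_all_finite (Set.finite_Iio _)]
    exact fun i _ => hdig i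
  obtain ⟨k, hk⟩ := hall.exists
  exact not_agree_of_reflected (hn₀ _ (Nat.le_add_right _ _)).1 (hγs (φ k)) (hγ1 (φ k)) hn
    (hlax.tail_eq_reflection hq hqM h1 hlax hn1) hk

/-! ### Approximation by strict orbits and by bases in 𝒰 -/

section Approximation

variable {α : DigitSeq M}

/-- The high contact makes the tail values periodic, so a minimum over one period is attained along
a whole arithmetic progression. -/
lemma LaxOrbit.exists_periodic_minimum (hq : 1 < q) (hqM : q < M + 1) (hα : LaxOrbit q α)
    (h1 : value q α = 1) (hh : HighContact q α) :
    ∃ p m : ℕ, 1 ≤ p ∧ ∀ k i, tailValue q α (m + k * p) ≤ tailValue q α i := by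
  obtain ⟨N, hN, hN1⟩ := hh
  have hper : Function.Periodic (tailValue q α) (N + 1) := fun i => by
    rw [add_comm, hα.tailValue_add hq hqM h1 hα hN1]
  obtain ⟨m, -, hm⟩ := Finset.exists_min_image (Finset.range (N + 1)) (tailValue q α) ⟨0, by simp⟩
  refine ⟨N + 1, m, by omega, fun k i => ?_⟩
  have h2 := hper.nat_mul k m
  rw [Nat.cast_id] at h2
  rw [h2, ← hper.map_mod_nat i]
  exact hm _ (Finset.mem_range.2 (Nat.mod_lt _ (by omega)))

/-- If the tail value of `α` at `m` is minimal, then the sequence obtained by repeating the first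
`m` digits of `α` and their reflections alternately has a strict orbit. -/
lemma LaxOrbit.exists_reflected_periodic (hq : 1 < q) (hqM : q < M + 1) (hα : LaxOrbit q α)
    (h1 : value q α = 1) (hl : ¬ LowContact q α) {m : ℕ} (hm : 1 ≤ m)
    (hmin : ∀ i, tailValue q α m ≤ tailValue q α i) :
    ∃ d : DigitSeq M, (∀ i, d (m + i) = reflection d i) ∧
      (∀ i, maxValue M q - 1 < tailValue q d i ∧ tailValue q d i < 1) ∧
      (q ^ m + 1) * (1 - value q d) = tailValue q α m - (maxValue M q - 1) := by
  have h0 : 0 < q := by linarith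
  let d : DigitSeq M := fun i => if Even (i / m) then α (i % m) else Fin.rev (α (i % m))
  have hda : ∀ i < m, d i = α i := by
    intro i hi
    simp [d, Nat.div_eq_of_lt hi, Nat.mod_eq_of_lt hi]
  have hdr : ∀ i, d (m + i) = reflection d i := by
    intro i
    by_cases h : Even (i / m) <;>
      simp [d, reflection, Nat.add_div_left i hm, Nat.even_add_one, h]
  have hdt : ∀ i, tailValue q d (m + i) = maxValue M q - tailValue q d i := by
    intro i
    rw [← tailValue_tail, funext hdr, ← tailValue_reflection hq]
  have hsub : ∀ i ≤ m, tailValue q d i - tailValue q α i = q ^ i * (value q d - 1) := by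
    intro i hi
    have := tailValue_sub_of_agree hq α d 0 0 i fun k hk => by
      simpa using (hda k (by omega)).symm
    simpa [tailValue_zero, h1] using this
  have hv : (q ^ m + 1) * (1 - value q d) = tailValue q α m - (maxValue M q - 1) := by
    have h2 := hsub m le_rfl
    have h3 := hdt 0
    rw [add_zero, tailValue_zero] at h3
    rw [h3] at h2
    linarith
  have hμ := hα.lt_tailValue hq hqM h1 hl m
  have hpos : 0 < 1 - value q d := by
    have h2 : 0 < q ^ m + 1 := by positivity
    by_contra! h
    nlinarith
  refine ⟨d, hdr, fun i => ?_, hv⟩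
  induction i using Nat.strong_induction_on with
  | _ i ih =>
    rcases lt_or_ge i m with hi | hi
    -- With v the value of `d`, the tail of `d` at i is that of α minus q^i(1-v). By minimality it
    -- exceeds the tail of α at m minus q^m(1-v), which equals K-1 + (1-v).
    · have h2 := hsub i hi.le
      have h3 : q ^ i ≤ q ^ m := pow_le_pow_right₀ hq.le hi.le
      have h4 : 0 < q ^ i := by positivity
      have h5 := hα.tailValue_le_one hq hqM h1 i
      have h6 := hmin i
      have h7 := mul_le_mul_of_nonneg_right h3 hpos.le
      have h8 := mul_pos h4 hpos
      constructor <;> linarith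
    · obtain ⟨j, rfl⟩ := Nat.exists_eq_add_of_le hi
      have h2 := ih j (by omega)
      rw [hdt]
      constructor <;> linarith

/-- The alternating sequence of block length m has value v with (q^m+1)(1-v) < 1; minima recur at
arbitrarily large m. -/
lemma LaxOrbit.exists_strict_near_one (hq : 1 < q) (hqM : q < M + 1) (hα : LaxOrbit q α)
    (h1 : value q α = 1) (hh : HighContact q α) (hl : ¬ LowContact q α) {ε : ℝ} (hε : 0 < ε) :
    ∃ d : DigitSeq M, (∀ i, maxValue M q - 1 < tailValue q d i ∧ tailValue q d i < 1) ∧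
      1 - ε < value q d := by
  obtain ⟨p, m, hp, hmin⟩ := hα.exists_periodic_minimum hq hqM h1 hh
  obtain ⟨k, hk⟩ := pow_unbounded_of_one_lt (1 / ε) hq
  have hmk : k + 1 ≤ m + (k + 1) * p := by nlinarith
  obtain ⟨d, -, hd, hv⟩ := hα.exists_reflected_periodic hq hqM h1 hl (by omega) (hmin (k + 1))
  refine ⟨d, hd, ?_⟩
  have hK := one_lt_maxValue hq hqM
  have h2 := hα.tailValue_le_one hq hqM h1 (m + (k + 1) * p)
  have h3 : q ^ k ≤ q ^ (m + (k + 1) * p) := pow_le_pow_right₀ hq.le (by omega)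
  have h4 : value q d < 1 := by
    rw [← tailValue_zero]
    exact (hd 0).2
  rw [div_lt_iff₀ hε] at hk
  by_contra! h
  have h5 : q ^ k * ε ≤ (q ^ (m + (k + 1) * p) + 1) * (1 - value q d) :=
    mul_le_mul (by linarith) (by linarith) hε.le (by positivity)
  linarith

/-- Replacing the tail of value 1 by a strict sequence of slightly smaller value lowers the earlier
tails by less than η. Upper bounds become strict, and the finitely many lower bounds have slack to
spare. -/
lemma LaxOrbit.exists_strict_near_of_highContact (hq : 1 < q) (hqM : q < M + 1)
    (hα : LaxOrbit q α) (h1 : value q α = 1) (hh : HighContact q α) (hl : ¬ LowContact q α)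
    {c : DigitSeq M} (hc : LaxOrbit q c) (hch : HighContact q c) (hcl : ¬ LowContact q c)
    {ε : ℝ} (hε : 0 < ε) : ∃ e : DigitSeq M, StrictOrbit q e ∧ |value q e - value q c| < ε := by
  obtain ⟨n, hn, hn1⟩ := hch
  have hev : ∀ᶠ η in 𝓝[>] (0 : ℝ), ∀ i ∈ Set.Iio (n + 1), 0 < (c i : ℕ) →
      η < tailValue q c (i + 1) - (maxValue M q - 1) := by
    rw [eventually_all_finite (Set.finite_Iio _)]
    intro i _
    by_cases hi : 0 < (c i : ℕ)
    · have h2 : maxValue M q - 1 < tailValue q c (i + 1) :=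
        ((hc i).2 hi).lt_of_ne' fun h => hcl ⟨i, hi, h⟩
      filter_upwards [(gt_mem_nhds (sub_pos.2 h2)).filter_mono nhdsWithin_le_nhds] with η h3 _
      exact h3
    · exact Eventually.of_forall fun η h => absurd h hi
  have hpos : ∀ᶠ η in 𝓝[>] (0 : ℝ), 0 < η := self_mem_nhdsWithin
  obtain ⟨η, hη, hη0, hηε⟩ :=
    (hev.and (hpos.and ((gt_mem_nhds hε).filter_mono nhdsWithin_le_nhds))).exists
  obtain ⟨d, hd, hdv⟩ := hα.exists_strict_near_one hq hqM h1 hh hl hη0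
  have hd1 : value q d < 1 := by
    rw [← tailValue_zero]
    exact (hd 0).2
  have hsub : ∀ i ≤ n + 1, tailValue q (splice c (n + 1) d) i < tailValue q c i ∧
      tailValue q c i - η < tailValue q (splice c (n + 1) d) i := by
    intro i hi
    have h2 := tailValue_splice_of_le hq c d hi
    have h3 : 1 ≤ q ^ (n + 1 - i) := one_le_pow₀ hq.le
    rw [hn1] at h2
    constructor
    · by_contra! h
      have : 0 ≤ q ^ (n + 1 - i) * (tailValue q (splice c (n + 1) d) i - tailValue q c i) :=
        mul_nonneg (by linarith) (by linarith)
      linarith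
    · by_contra! h
      have : q ^ (n + 1 - i) * (tailValue q (splice c (n + 1) d) i - tailValue q c i) ≤
          1 * (tailValue q (splice c (n + 1) d) i - tailValue q c i) :=
        mul_le_mul_of_nonpos_right h3 (by linarith)
      linarith
  refine ⟨splice c (n + 1) d, fun i => ?_, ?_⟩
  · rcases Nat.lt_or_ge i (n + 1) with hi | hi
    · rw [splice_of_lt c d hi]
      have h2 := hsub (i + 1) hi
      refine ⟨fun h => h2.1.trans_le ((hc i).1 h), fun h => ?_⟩
      have := hη i hi h
      linarith
    · obtain ⟨j, rfl⟩ := Nat.exists_eq_add_of_le hi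
      rw [add_assoc (n + 1) j 1, tailValue_splice_add]
      exact ⟨fun _ => (hd _).2, fun _ => (hd _).1⟩
  · have h2 := hsub 0 (Nat.zero_le _)
    rw [tailValue_zero, tailValue_zero] at h2
    rw [abs_lt]
    constructor <;> linarith

lemma LaxOrbit.exists_strict_near (hq : 1 < q) (hqM : q < M + 1)
    (hα : LaxOrbit q α) (h1 : value q α = 1) (hh : HighContact q α) (hl : ¬ LowContact q α)
    {c : DigitSeq M} (hc : LaxOrbit q c) {ε : ℝ} (hε : 0 < ε) :
    ∃ e : DigitSeq M, StrictOrbit q e ∧ |value q e - value q c| < ε := by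
  have hnc := hα.not_contact hq hqM h1 hl hc
  by_cases hch : HighContact q c
  · exact hα.exists_strict_near_of_highContact hq hqM h1 hh hl hc hch (fun h => hnc ⟨hch, h⟩) hε
  by_cases hcl : LowContact q c
  · obtain ⟨e, he, hec⟩ := hα.exists_strict_near_of_highContact hq hqM h1 hh hl (hc.reflect hq)
      ((highContact_reflection hq).2 hcl) (fun h => hch ((lowContact_reflection hq).1 h)) hε
    refine ⟨reflection e, he.reflect hq, ?_⟩
    rw [value_reflection hq] at hec ⊢
    rw [abs_lt] at hec ⊢
    constructor <;> linarith [hec.1, hec.2]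
  · exact ⟨c, hc.strictOrbit hch hcl, by simpa using hε⟩

/-- Compare the orbit of `1` along `α` in base `q` with its orbit in a smaller base. -/
lemma tailValue_sub_of_base_lt {r : ℝ} (hr : 1 < r) (hrq : r < q) {c : DigitSeq M} {m : ℕ}
    (hpos : ∀ i, 0 < tailValue q α i) (hagree : ∀ i < m, c i = α i)
    (hv : value r c = value q α) {i : ℕ} (hi : i < m) :
    tailValue r c (i + 1) < tailValue q α (i + 1) ∧
      tailValue q α (i + 1) - tailValue r c (i + 1) ≤ tailValue q α m - tailValue r c m := by
  have hq : 1 < q := hr.trans hrq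
  have hstep : ∀ i < m, 0 ≤ tailValue q α i - tailValue r c i →
      tailValue q α i - tailValue r c i < tailValue q α (i + 1) - tailValue r c (i + 1) := by
    intro i hi h
    rw [tailValue_succ hq, tailValue_succ hr, hagree i hi]
    -- For t = `tailValue q α i` and s = `tailValue r c i`, the new gap is qt - rs = r(t-s) +
    -- (q-r)t.
    nlinarith [hpos i, mul_nonneg (sub_nonneg.2 hr.le) h, mul_pos (sub_pos.2 hrq) (hpos i)]
  have hnn : ∀ i ≤ m, 0 ≤ tailValue q α i - tailValue r c i := by
    intro i
    induction i with
    | zero => simp [tailValue_zero, hv]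
    | succ i ih =>
      intro hi
      have h := ih (by omega)
      exact h.trans (hstep i hi h).le
  have hmono : ∀ j, i + 1 + j ≤ m → tailValue q α (i + 1) - tailValue r c (i + 1) ≤
      tailValue q α (i + 1 + j) - tailValue r c (i + 1 + j) := by
    intro j
    induction j with
    | zero => simp
    | succ j ih =>
      intro hj
      exact (ih (by omega)).trans (hstep _ (by omega) (hnn _ (by omega))).le
  constructor
  · have h2 := hnn i hi.le
    have h3 := hstep i hi h2
    linarith
  · have := hmono (m - (i + 1)) (by omega)
    rwa [Nat.add_sub_cancel' hi] at this

/-- Follow α up to a late minimum μ of its tail values, then the reflected alternating sequence `e`,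
whose value is below μ. In base q the result is below 1, in a slightly smaller base at least 1, so
in between it expands 1; the orbit is strict there. -/
lemma LaxOrbit.mem_closure_basesU (hq : 1 < q) (hqM : q < M + 1) (hα : LaxOrbit q α)
    (h1 : value q α = 1) (hh : HighContact q α) (hl : ¬ LowContact q α) :
    q ∈ closure (basesU M) := by
  have hK := one_lt_maxValue hq hqM
  obtain ⟨p, m, hp, hmin⟩ := hα.exists_periodic_minimum hq hqM h1 hh
  have hlow := hα.lt_tailValue hq hqM h1 hl
  have hmp : 1 ≤ m + 1 * p := by omega
  obtain ⟨d, hdr, hd, hdv⟩ := hα.exists_reflected_periodic hq hqM h1 hl hmp (hmin 1)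
  set m₀ := m + 1 * p
  set μ := tailValue q α m₀
  have hμ : ∀ k, tailValue q α (m + k * p) = μ := fun k => le_antisymm (hmin k _) (hmin 1 _)
  let e : DigitSeq M := reflection d
  have hqm : 1 < q ^ m₀ := one_lt_pow₀ hq (by omega)
  have heμ : value q e < μ := by
    rw [value_reflection hq]
    have h2 : value q d < 1 := by
      rw [← tailValue_zero]
      exact (hd 0).2
    nlinarith
  have het : ∀ i, maxValue M q - 1 < tailValue q e i ∧ tailValue q e i < 1 := by
    intro i
    rw [tailValue_reflection hq]
    have := hd i
    constructor <;> linarith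
  have heper : ∀ r, Function.Periodic (tailValue r e) (2 * m₀) := by
    intro r i
    have h2 : ∀ i, e (i + 2 * m₀) = e i := by
      intro i
      have h3 : d (i + 2 * m₀) = d i := by
        rw [show i + 2 * m₀ = m₀ + (m₀ + i) by ring, hdr, reflection, hdr]
        simp [reflection]
      simp only [e, reflection, h3]
    unfold tailValue
    congr 1
    funext k
    rw [show i + 2 * m₀ + k = i + k + 2 * m₀ by ring, h2]
  -- Periodicity of `e` reduces strictness of all its tails to finitely many open conditions on the
  -- base.
  have hev : ∀ᶠ r in 𝓝 q, (1 < r ∧ value r e < μ) ∧ ∀ i ∈ Set.Iio (2 * m₀),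
      maxValue M r - 1 < tailValue r e i ∧ tailValue r e i < 1 := by
    refine ((lt_mem_nhds hq).and ?_).and ?_
    · have h2 := (continuousAt_tailValue_base hq e 0).eventually (gt_mem_nhds
        (show tailValue q e 0 < μ by rwa [tailValue_zero]))
      simpa only [tailValue_zero] using h2
    · rw [eventually_all_finite (Set.finite_Iio _)]
      intro i _
      have hc := continuousAt_tailValue_base hq e i
      exact (((continuousAt_maxValue hq).sub continuousAt_const).eventually_lt hc (het i).1).and
        (hc.eventually (gt_mem_nhds (het i).2))
  have hev' := hev.filter_mono (nhdsWithin_le_nhds (s := Set.Iio q))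
  obtain ⟨a, haq, ha⟩ := mem_nhdsLT_iff_exists_Ioo_subset.1 hev'
  rw [Metric.mem_closure_iff]
  intro ε hε
  obtain ⟨r₀, hr₀, hr₀q⟩ := exists_between (max_lt (show a < q from haq) (sub_lt_self q hε))
  rw [max_lt_iff] at hr₀
  have hr₀1 : 1 < r₀ := (ha ⟨hr₀.1, hr₀q⟩).1.1
  have hgt : 1 < value r₀ α :=
    h1 ▸ value_lt_of_base_lt hr₀1 hr₀q α (hα.digit_zero_pos hq hqM h1)
  obtain ⟨k, hk⟩ := pow_unbounded_of_one_lt (maxValue M r₀ / (value r₀ α - 1)) hr₀1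
  rw [div_lt_iff₀ (sub_pos.2 hgt)] at hk
  have hmk : k ≤ m + k * p := by nlinarith
  let c := splice α (m + k * p) e
  have hc0 : 1 ≤ value r₀ c := by
    have h2 := tailValue_splice_of_le hr₀1 α e (Nat.zero_le (m + k * p))
    rw [tailValue_zero, tailValue_zero, Nat.sub_zero] at h2
    have h3 := value_nonneg hr₀1 e
    have h4 := tailValue_le hr₀1 α (m + k * p)
    have h5 : r₀ ^ k ≤ r₀ ^ (m + k * p) := pow_le_pow_right₀ hr₀1.le hmk
    by_contra! h
    have h6 : r₀ ^ k * (value r₀ α - 1) ≤ r₀ ^ (m + k * p) * (value r₀ α - value r₀ c) :=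
      mul_le_mul h5 (by linarith) (by linarith) (by positivity)
    change _ = _ * (value r₀ c - _) at h2
    linarith
  have hcq : value q c < 1 := by
    have h2 := tailValue_splice_of_le hq α e (Nat.zero_le (m + k * p))
    rw [tailValue_zero, tailValue_zero, Nat.sub_zero, hμ, h1] at h2
    by_contra! h
    have : 0 ≤ q ^ (m + k * p) * (value q c - 1) := mul_nonneg (by positivity) (by linarith)
    linarith
  have hcont : ContinuousOn (fun r => value r c) (Set.Icc r₀ q) := by
    intro r hr
    have := continuousAt_tailValue_base (hr₀1.trans_le hr.1) c 0
    simp only [tailValue_zero] at this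
    exact this.continuousWithinAt
  obtain ⟨r, ⟨hr0, hrq⟩, hr1⟩ := intermediate_value_Icc' hr₀q.le hcont ⟨hcq.le, hc0⟩
  have hrq : r < q := hrq.lt_of_ne fun h => by
    rw [h] at hr1
    exact hcq.ne hr1
  obtain ⟨⟨hr, hreμ⟩, hre⟩ := ha ⟨hr₀.1.trans_le hr0, hrq⟩
  have hre' : ∀ i, maxValue M r - 1 < tailValue r e i ∧ tailValue r e i < 1 := by
    intro i
    rw [← (heper r).map_mod_nat i]
    exact hre _ (Nat.mod_lt _ (by omega))
  refine ⟨r, (mem_basesU_iff hr (by linarith)).2 ⟨c, hr1, fun i => ?_⟩, ?_⟩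
  · suffices h : maxValue M r - 1 < tailValue r c (i + 1) ∧ tailValue r c (i + 1) < 1 from
      ⟨fun _ => h.2, fun _ => h.1⟩
    rcases Nat.lt_or_ge i (m + k * p) with hi | hi
    -- Along the α block the gap never exceeds its final size, μ minus the value of `e` in base r;
    -- as tails of α are at least μ, those of `c` are at least that value.
    · obtain ⟨h2, h3⟩ := tailValue_sub_of_base_lt hr hrq (fun i => by linarith [hlow i])
        (fun i hi => splice_of_lt α e hi) (hr1.trans h1.symm) hi
      have h4 : tailValue r c (m + k * p) = tailValue r e 0 := tailValue_splice_add α e _ 0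
      rw [hμ, h4] at h3
      have h5 := hα.tailValue_le_one hq hqM h1 (i + 1)
      have h6 : μ ≤ tailValue q α (i + 1) := hmin 1 _
      have h7 := (hre' 0).1
      constructor <;> linarith
    · obtain ⟨j, rfl⟩ := Nat.exists_eq_add_of_le hi
      rw [add_assoc (m + k * p) j 1, show tailValue r c (m + k * p + (j + 1)) = _ from
        tailValue_splice_add α e _ (j + 1)]
      exact hre' (j + 1)
  · rw [Real.dist_eq, abs_lt]
    constructor <;> linarith

end Approximation

/-! ### Assembly of the two cases -/

lemma doublyInfiniteExpansions_setU (hq : 1 < q) (hqM : q < M + 1) :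
    doublyInfiniteExpansions M q (setU M q) = seqU M q := by
  ext c
  constructor
  · rintro ⟨x, hx, hc, -⟩
    exact ⟨x, hx, hc⟩
  · intro hc
    have hdi := ((mem_seqU_iff hq hqM).1 hc).lax.isDoublyInfinite hq hqM
    obtain ⟨x, hx, hcx⟩ := hc
    exact ⟨x, hx, hcx, hdi⟩

lemma seqG_eq_seqV (hq : 1 < q) (hqM : q < M + 1) {α : DigitSeq M} (hα : LaxOrbit q α)
    (h1 : value q α = 1) (hh : HighContact q α) (hl : ¬ LowContact q α) :
    seqG M q = seqV M q := by
  ext c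
  rw [mem_seqV_iff hq hqM]
  exact ⟨laxOrbit_of_mem_seqG hq, fun hc => mem_seqG_of_not_contact hq hqM
    (one_mem_pointsA (hα.exists_greedy hq hqM h1 hh)) hc (hα.not_contact hq hqM h1 hl hc)⟩

lemma seqG_eq_seqU (hq : 1 < q) (hqM : q < M + 1) {α : DigitSeq M} (hα : LaxOrbit q α)
    (h1 : value q α = 1) (hl : LowContact q α) : seqG M q = seqU M q := by
  ext c
  rw [mem_seqU_iff hq hqM]
  constructor
  · intro hc
    refine (laxOrbit_of_mem_seqG hq hc).strictOrbit
      (not_highContact_of_mem_seqG hq hqM hα h1 hl hc) ?_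
    rw [← highContact_reflection hq]
    exact not_highContact_of_mem_seqG hq hqM hα h1 hl (seqG_reflection hq hc)
  · rintro hc
    refine mem_seqG_of_not_contact hq hqM (one_mem_pointsA (hα.exists_greedy hq hqM h1
      (hα.highContact_of_lowContact hq hqM h1 hl))) hc.lax ?_
    rintro ⟨⟨n, hn, hn1⟩, -⟩
    exact ((hc n).1 hn).ne hn1

lemma closure_setU_eq_setV (hq : 1 < q) (hqM : q < M + 1) {α : DigitSeq M} (hα : LaxOrbit q α)
    (h1 : value q α = 1) (hh : HighContact q α) (hl : ¬ LowContact q α) :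
    closure (setU M q) = setV M q := by
  have hU : seqU M q = {c | StrictOrbit q c} := Set.ext fun c => mem_seqU_iff hq hqM
  have hV : seqV M q = {c | LaxOrbit q c} := Set.ext fun c => mem_seqV_iff hq hqM
  rw [setU_eq_image, setV_eq_image, hU, hV]
  refine (closure_minimal (Set.image_mono fun c (hc : StrictOrbit q c) => hc.lax)
    (isClosed_image_value hq (isClosed_setOf_laxOrbit hq))).antisymm ?_
  rintro x ⟨c, hc, rfl⟩
  rw [Metric.mem_closure_iff]
  intro ε hε
  obtain ⟨e, he, hec⟩ := LaxOrbit.exists_strict_near hq hqM hα h1 hh hl hc hε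
  exact ⟨value q e, ⟨e, he, rfl⟩, by rwa [dist_comm, Real.dist_eq]⟩

lemma closure_setU_eq_setU (hq : 1 < q) (hqM : q < M + 1) {α : DigitSeq M} (hα : LaxOrbit q α)
    (h1 : value q α = 1) (hl : LowContact q α) : closure (setU M q) = setU M q := by
  have hU : seqU M q = {c | StrictOrbit q c} := Set.ext fun c => mem_seqU_iff hq hqM
  rw [setU_eq_image, hU]
  exact (isClosed_image_value hq (isClosed_setOf_strictOrbit hq hqM hα h1 hl)).closure_eq

end UnivoqueGraph

open UnivoqueGraph
theorem theorem1p1 (M : ℕ) (hM : 1 ≤ M) (q : ℝ) :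
    (q ∈ closure (basesU M) \ basesU M → setG M q = setV M q ∧ seqG M q = seqV M q) ∧
    (q ∈ basesV M \ closure (basesU M) → setG M q = setU M q ∧ seqG M q = seqU M q) ∧
    (q ∈ basesV M \ basesU M →
      setG M q = closure (setU M q) ∧
      seqG M q = doublyInfiniteExpansions M q (closure (setU M q))) := by
  have hV : q ∈ basesV M \ basesU M → 1 < q ∧ q < M + 1 ∧
      ∃ α : DigitSeq M, LaxOrbit q α ∧ value q α = 1 ∧ HighContact q α := by
    rintro ⟨hV, hU⟩
    have hq : 1 < q := hV.1.1
    have hqM : q < M + 1 := hV.1.2.lt_of_ne fun h => hU (h ▸ succ_mem_basesU hM)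
    obtain ⟨α, h1, hα⟩ := (mem_basesV_iff hq hqM).1 hV
    exact ⟨hq, hqM, α, hα, h1, hα.highContact hq hqM h1 hU⟩
  refine ⟨?_, ?_, ?_⟩
  · rintro ⟨hcl, hU⟩
    obtain ⟨hq, hqM, α, hα, h1, hl⟩ := exists_of_mem_closure_basesU hM hcl hU
    have h := seqG_eq_seqV hq hqM hα h1 (hα.highContact hq hqM h1 hU) hl
    exact ⟨by rw [setG, h, setV_eq_image], h⟩
  · rintro ⟨hqV, hcl⟩
    obtain ⟨hq, hqM, α, hα, h1, hh⟩ := hV ⟨hqV, fun h => hcl (subset_closure h)⟩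
    have h := seqG_eq_seqU hq hqM hα h1
      (by_contra fun hl => hcl (hα.mem_closure_basesU hq hqM h1 hh hl))
    exact ⟨by rw [setG, h, setU_eq_image], h⟩
  · intro hq'
    obtain ⟨hq, hqM, α, hα, h1, hh⟩ := hV hq'
    -- The uniform statement follows from the dichotomy for α alone, without reference to the
    -- closure of 𝒰.
    by_cases hl : LowContact q α
    · have h := seqG_eq_seqU hq hqM hα h1 hl
      rw [closure_setU_eq_setU hq hqM hα h1 hl, doublyInfiniteExpansions_setU hq hqM]
      exact ⟨by rw [setG, h, setU_eq_image], h⟩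
    · have h := seqG_eq_seqV hq hqM hα h1 hh hl
      rw [closure_setU_eq_setV hq hqM hα h1 hh hl]
      exact ⟨by rw [setG, h, setV_eq_image], h⟩
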